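/- Let $\Bbbk$ be a unital commutative ring. A generalized Coxeter matrix is a symmetric matrix $M=(m_{ij})_{i,j\in I}$, $I$ finite, with $m_{ij}\in\{2,3,\dots,\infty\}$ for $i\ne j$ and $m_{ii}\in\{0,1,2,\dots\}$. The algebra $NC(M)$ is the $\Bbbk$-algebra generated by $T_i$ ($i\in I$) subject to the braid relations $T_iT_jT_i\cdots=T_jT_iT_j\cdots$ ($m_{ij}$ factors on each side) for all $i\neq j$ with $m_{ij}<\infty$, and $T_i^{m_{ii}}=0$ for all $i$. Let $\mathfrak m\subset NC(M)$ be the two-sided ideal generated by the $T_i$, and put $$\mathrm{Prim}_L=\{x:\mathfrak m x=0\},\qquad \mathrm{Prim}_R=\{x:x\mathfrak m=0\},\qquad \mathrm{Prim}=\mathrm{Prim}_L\cap\mathrm{Prim}_R .$$ The length of a product of generators in $NC(M)$ is the least number of factors in an expression for it as a product of generators. For $n\ge1$, $d\ge2$ let $NC_A(n,d)=NC(M)$ for $M$ of type $A_n$ with diagonal $(2,\dots,2,d)$; its generators are $T_1,\dots,T_n$. Every $NC(M)$ has a $\Bbbk$-linear anti-involution $\theta$ fixing each $T_i$. It satisfies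 $\theta(\mathrm{Prim}_L)=\mathrm{Prim}_R$, $\theta(\mathrm{Prim}_R)=\mathrm{Prim}_L$ and $\theta(\mathrm{Prim})=\mathrm{Prim}$. If a word $T_{i_1}\cdots T_{i_l}$ is nonzero in $NC(M)$, then its length is $l$, and its image under $\theta$ is a word of the same length. Moreover: 1. If $m_{ii}=2$ for all $i$ and the Coxeter group $W(M)$ is finite, then $W(M)$ has a unique element $w_\circ$ of maximal length, and $\mathrm{Prim}_L=\mathrm{Prim}_R=\mathrm{Prim}=\Bbbk\,T_{w_\circ}$, where $T_{w_\circ}=T_{i_1}\cdots T_{i_l}$ for any reduced expression $w_\circ=s_{i_1}\cdots s_{i_l}$. 2. For $NC_A(1,d)$ with $d\ge2$, $\mathrm{Prim}_L=\mathrm{Prim}_R=\mathrm{Prim}=\Bbbk\,T_1^{d-1}$. 3. Let $n\ge2$ and $d\ge3$. Let $w'_\circ$ be the longest element of the symmetric group $S_n$, and let $T_{w'_\circ}\in NC_A(n,d)$ be the product of the generators $T_1,\dots,T_{n-1}$ along any reduced expression of $w'_\circ$ in the adjacent transpositions $s_i=(i,i+1)$, $1\le i\le n-1$. In $NC_A(n,d)$: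 (a) $\mathrm{Prim}_L$ is spanned by $T_{w'_\circ}T_nT_{n-1}\cdots T_1$ and the $n(d-2)$ words $T_{w'_\circ}T_n^kT_{n-1}\cdots T_m$ with $2\le k\le d-1$, $1\le m\le n$, and these $1+n(d-2)$ words are linearly independent over $\Bbbk$. (b) $\mathrm{Prim}$ is spanned by the $d-1$ words $T_{w'_\circ}T_n^kT_{n-1}\cdots T_1$ with $1\le k\le d-1$, and these are linearly independent over $\Bbbk$. In cases 1, 2 and 3, $\theta$ fixes every element of $\mathrm{Prim}$. -/

import Mathlib

/-- A generalized Coxeter matrix: a symmetric matrix with entries in `{0, 1, 2, …} ∪ {∞}`, with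
off-diagonal entries at least `2` (possibly `∞`) and finite diagonal entries. -/
structure GenCoxeterMatrix (I : Type*) where
  m : I → I → ℕ∞
  symm : ∀ i j, m i j = m j i
  two_le : ∀ i j, i ≠ j → 2 ≤ m i j
  diag_ne_top : ∀ i, m i i ≠ ⊤

namespace GenCoxeterMatrix

/-- The Coxeter matrix (in Mathlib's conventions: diagonal `1`, and `0` for `∞`) with the
off-diagonal entries of `M`. When all diagonal entries of `M` are `2`, its Coxeter group is the
group `W(M)`. -/
noncomputable def coxeterMatrix {I : Type*} (M : GenCoxeterMatrix I) : CoxeterMatrix I := by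
  classical
  exact
  { M := Matrix.of fun i j => if i = j then 1 else (M.m i j).toNat
    isSymm := by
      ext i j
      simp only [Matrix.transpose_apply, Matrix.of_apply, M.symm j i, eq_comm (a := j)]
    diagonal := fun i => by simp
    off_diagonal := fun i j hij => by
      have h2 := M.two_le i j hij
      simp only [Matrix.of_apply, if_neg hij]
      intro h
      cases hm : M.m i j with
      | top => simp [hm] at h
      | coe a =>
        rw [hm] at h h2
        simp only [ENat.toNat_natCast] at h
        subst h
        exact absurd h2 (by decide) }

/-- The defining relations of the generalized nil-Coxeter algebra `NC(M)` on the free algebra: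
the braid relations (both sides alternating words with `m i j` letters, omitted if
`m i j = ∞`) and the nilpotence relations `T_i ^ (m i i) = 0`. -/
inductive NCRel (k : Type*) [CommRing k] {I : Type*} (M : GenCoxeterMatrix I) :
    FreeAlgebra k I → FreeAlgebra k I → Prop
  | braid (i j : I) (a : ℕ) (hij : i ≠ j) (ha : M.m i j = a) :
      NCRel k M
        ((CoxeterSystem.alternatingWord i j a).map (FreeAlgebra.ι k)).prod
        ((CoxeterSystem.alternatingWord j i a).map (FreeAlgebra.ι k)).prod
  | order (i : I) : NCRel k M (FreeAlgebra.ι k i ^ (M.m i i).toNat) 0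

/-- The generalized nil-Coxeter algebra `NC(M)` over `k`. -/
abbrev NC (k : Type*) [CommRing k] {I : Type*} (M : GenCoxeterMatrix I) : Type _ :=
  RingQuot (NCRel k M)

section

variable (k : Type*) [CommRing k] {I : Type*} (M : GenCoxeterMatrix I)

/-- The generator `T_i` of `NC(M)`. -/
noncomputable def T (i : I) : NC k M :=
  RingQuot.mkAlgHom k (NCRel k M) (FreeAlgebra.ι k i)

/-- The word `T_{i_1} ⋯ T_{i_l}` in `NC(M)`. -/
noncomputable def word (ω : List I) : NC k M := (ω.map (T k M)).prod

/-- The two-sided ideal `𝔪` of `NC(M)` generated by the `T_i`. -/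
def maxIdeal : TwoSidedIdeal (NC k M) := TwoSidedIdeal.span (Set.range (T k M))

/-- The left-primitive elements: those `x` with `𝔪 x = 0`. -/
def primL : Submodule k (NC k M) where
  carrier := {x | ∀ y ∈ maxIdeal k M, y * x = 0}
  add_mem' := fun ha hb y hy => by rw [mul_add, ha y hy, hb y hy, add_zero]
  zero_mem' := fun y _ => mul_zero y
  smul_mem' := fun c x hx y hy => by rw [mul_smul_comm, hx y hy, smul_zero]

/-- The right-primitive elements: those `x` with `x 𝔪 = 0`. -/
def primR : Submodule k (NC k M) where
  carrier := {x | ∀ y ∈ maxIdeal k M, x * y = 0}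
  add_mem' := fun ha hb y hy => by rw [add_mul, ha y hy, hb y hy, add_zero]
  zero_mem' := fun y _ => zero_mul y
  smul_mem' := fun c x hx y hy => by rw [smul_mul_assoc, hx y hy, smul_zero]

/-- The (two-sided) primitive elements. -/
def prim : Submodule k (NC k M) := primL k M ⊓ primR k M

/-- `θ` is an anti-involution of the `k`-algebra `NC(M)` fixing each generator `T_i`. -/
structure IsAntiInvolution (θ : NC k M →ₗ[k] NC k M) : Prop where
  map_one : θ 1 = 1
  map_mul : ∀ x y, θ (x * y) = θ y * θ x
  involutive : ∀ x, θ (θ x) = x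
  map_T : ∀ i, θ (T k M i) = T k M i

end

/-- The matrix of type `A_n` with diagonal `(2, …, 2, d)`; the index `i : Fin n` stands for the
`(i + 1)`-st node. -/
def typeA (n d : ℕ) : GenCoxeterMatrix (Fin n) where
  m i j :=
    if i = j then (if i.val + 1 = n then (d : ℕ∞) else 2)
    else if i.val + 1 = j.val ∨ j.val + 1 = i.val then 3 else 2
  symm i j := by
    by_cases h : i = j
    · subst h; rfl
    · rw [if_neg h, if_neg (Ne.symm h)]
      simp only [or_comm]
  two_le i j hij := by
    rw [if_neg hij]
    split_ifs
    · exact_mod_cast (by decide : (2 : ℕ) ≤ 3)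
    · exact le_rfl
  diag_ne_top i := by
    rw [if_pos rfl]
    split_ifs
    · exact ENat.natCast_ne_top d
    · exact ENat.natCast_ne_top 2

/-- The algebra `NC_A(n, d)`, with generators `T_1, …, T_n` indexed by `Fin n`. -/
abbrev NCA (k : Type*) [CommRing k] (n d : ℕ) : Type _ := NC k (typeA n d)

end GenCoxeterMatrix

/-- The least length of a word in the `s i` with product `g`. -/
noncomputable def wordLength {I G : Type*} [Monoid G] (s : I → G) (g : G) : ℕ :=
  sInf {l | ∃ ω : List I, (ω.map s).prod = g ∧ ω.length = l}

/-- The generators `s_i = (i, i + 1)`, `1 ≤ i ≤ r`, of the symmetric group `S_{r+1}`. -/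
def adjSwap (r : ℕ) (i : Fin r) : Equiv.Perm (Fin (r + 1)) := Equiv.swap i.castSucc i.succ

/-- `ω` is a reduced word, in the `s_i`, of an element of maximal length of `S_{r+1}`. -/
def IsLongestWord (r : ℕ) (ω : List (Fin r)) : Prop :=
  wordLength (adjSwap r) (ω.map (adjSwap r)).prod = ω.length ∧
    ∀ g : Equiv.Perm (Fin (r + 1)), wordLength (adjSwap r) g ≤ ω.length

namespace GenCoxeterMatrix

/-- For `n = r + 1`, the word `T_w T_n^a T_{n-1} ⋯ T_{m+1} T_m` of `NC_A(n, d)`, where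
`ω` is a word for `w` in `s_1, …, s_{n-1}`, and `m : Fin n` stands for the node `m + 1`. -/
noncomputable def stdWord (k : Type*) [CommRing k] (r d : ℕ) (ω : List (Fin r)) (a : ℕ)
    (m : Fin (r + 1)) : NCA k (r + 1) d :=
  word k (typeA (r + 1) d) (ω.map Fin.castSucc) *
    T k (typeA (r + 1) d) (Fin.last r) ^ a *
    word k (typeA (r + 1) d)
      (((List.finRange r).map Fin.castSucc).filter fun j => m ≤ j).reverse

/-- The pairs `(a, m)` indexing the left-primitive words `T_{w'} T_n^a T_{n-1} ⋯ T_m` of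
`NC_A(n, d)`, `n = r + 1`: the pair of `T_{w'} T_n T_{n-1} ⋯ T_1`, and the `n (d - 2)` pairs
with `a ∈ [2, d - 1]`, `m ∈ [1, n]`. -/
def leftPrimIndex (r d : ℕ) : Finset (ℕ × Fin (r + 1)) :=
  insert (1, 0) (Finset.Icc 2 (d - 1) ×ˢ Finset.univ)

end GenCoxeterMatrix

/-! All descriptions of primitive elements come from bases of `NC(M)` on which every generator acts
by a partial injection: each `T_i` sends a basis element to a basis element or to zero, and distinct
ones with nonzero image have distinct images. On such a basis `T_i` kills a linear combination only
if it kills every basis element in its support, so `Prim_L` is spanned by the basis elements killed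
by all generators (`NormalForm.primL_eq`). To obtain such a basis, one writes down partial maps that
satisfy the defining relations, which gives a representation on the free module, and checks that
candidate words multiply as the partial maps prescribe. Applying the representation to the base
point then separates the candidates.

For a finite Coxeter group the index set is `W(M)` and `T_i` acts by length-increasing left
multiplication. Products along reduced words are well defined by Matsumoto's theorem, which rests on
the exchange property and on `s_i s_j` having order exactly `m_ij`, the latter seen in the geometric
representation. The only element with all left descents is the longest one.

For `NC_A(n, d)` the index is a pair `(L, a)`: `L` lists the lengths of descending blocks `T_j
T_{j-1} ⋯` in the staircase normal form of type `A`, and `a` is the exponent of `T_n` at the start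
of the last block. Multiplication by a generator exchanges two neighbouring block lengths and adds a
letter (`IsBraidSeq.mul_stair`), or raises `a`, or gives zero (`T_mul_nfA`). The pairs killed by
everything have all blocks before the last of full length (`typeAAct_eq_none_iff`).

The right-hand side is reached through the anti-involution `θ`. In `NC_A(n, d)`, right
multiplication by `T_{m-1}` lengthens the tail ending in `T_m` (`primWord_mul_genA`), so a primitive
element involves only tails ending in `T_1`. These words are fixed by `θ` (`map_primWord`), hence
also right-primitive. -/

namespace GenCoxeterMatrix

/-! ### Words, primitive elements, the anti-involution and the grading for arbitrary `M`. -/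

section Basics

variable (k : Type*) [CommRing k] {I : Type*} (M : GenCoxeterMatrix I)

theorem word_nil : word k M [] = 1 := rfl

theorem word_cons (i : I) (ω : List I) : word k M (i :: ω) = T k M i * word k M ω := by
  simp [word]

theorem word_append (ω ω' : List I) : word k M (ω ++ ω') = word k M ω * word k M ω' := by
  simp [word]

theorem word_eq_mkAlgHom (ω : List I) :
    word k M ω = RingQuot.mkAlgHom k (NCRel k M) (ω.map (FreeAlgebra.ι k)).prod := by
  rw [map_list_prod, List.map_map]
  rfl

theorem word_alternatingWord (i j : I) (a : ℕ) (hij : i ≠ j) (ha : M.m i j = a) :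
    word k M (CoxeterSystem.alternatingWord i j a) =
      word k M (CoxeterSystem.alternatingWord j i a) := by
  rw [word_eq_mkAlgHom, word_eq_mkAlgHom]
  exact RingQuot.mkAlgHom_rel k (NCRel.braid i j a hij ha)

theorem T_pow_eq_zero (i : I) : T k M i ^ (M.m i i).toNat = 0 := by
  have := RingQuot.mkAlgHom_rel k (NCRel.order (k := k) (M := M) i)
  rwa [map_pow, map_zero] at this

/-- The universal property of `NC(M)`. -/
noncomputable def NC.lift {B : Type*} [Ring B] [Algebra k B] (f : I → B)
    (hbraid : ∀ (i j : I) (a : ℕ), i ≠ j → M.m i j = a →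
      ((CoxeterSystem.alternatingWord i j a).map f).prod =
        ((CoxeterSystem.alternatingWord j i a).map f).prod)
    (horder : ∀ i, f i ^ (M.m i i).toNat = 0) : NC k M →ₐ[k] B :=
  RingQuot.liftAlgHom k ⟨FreeAlgebra.lift k f, by
    intro x y h
    induction h with
    | braid i j a hij ha =>
      simpa [map_list_prod, List.map_map, Function.comp_def] using hbraid i j a hij ha
    | order i => simpa using horder i⟩

theorem NC.lift_T {B : Type*} [Ring B] [Algebra k B] (f : I → B) (hbraid) (horder) (i : I) :
    NC.lift k M f hbraid horder (T k M i) = f i := by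
  simp [NC.lift, T]

theorem NC.lift_word {B : Type*} [Ring B] [Algebra k B] (f : I → B) (hbraid) (horder)
    (ω : List I) : NC.lift k M f hbraid horder (word k M ω) = (ω.map f).prod := by
  rw [word, map_list_prod, List.map_map]
  congr 1
  exact List.map_congr_left fun i _ => NC.lift_T k M f hbraid horder i

theorem span_word : Submodule.span k (Set.range (word k M)) = ⊤ := by
  rw [eq_top_iff]
  rintro x -
  obtain ⟨y, rfl⟩ := RingQuot.mkAlgHom_surjective k (NCRel k M) x
  induction y using FreeAlgebra.induction with
  | grade0 r =>
    rw [AlgHom.commutes, Algebra.algebraMap_eq_smul_one]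
    exact Submodule.smul_mem _ _ (Submodule.subset_span ⟨[], rfl⟩)
  | grade1 i => exact Submodule.subset_span ⟨[i], by simp [word, T]⟩
  | add a b ha hb => rw [map_add]; exact add_mem ha hb
  | mul a b ha hb =>
    rw [map_mul]
    have h := Submodule.mul_mem_mul ha hb
    rw [Submodule.span_mul_span] at h
    refine Submodule.span_mono ?_ h
    rintro _ ⟨_, ⟨ω, rfl⟩, _, ⟨ω', rfl⟩, rfl⟩
    exact ⟨ω ++ ω', word_append k M ω ω'⟩

@[elab_as_elim]
theorem word_induction {p : NC k M → Prop} (x : NC k M) (word : ∀ ω, p (word k M ω))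
    (add : ∀ x y, p x → p y → p (x + y)) (smul : ∀ (c : k) x, p x → p (c • x)) : p x := by
  have hx : x ∈ Submodule.span k (Set.range (GenCoxeterMatrix.word k M)) := by
    rw [span_word]; trivial
  induction hx using Submodule.span_induction with
  | mem x h => obtain ⟨ω, rfl⟩ := h; exact word ω
  | zero => simpa using smul 0 _ (word [])
  | add x y _ _ hx hy => exact add x y hx hy
  | smul c x _ hx => exact smul c x hx

/-! ### Primitive elements -/

theorem T_mem_maxIdeal (i : I) : T k M i ∈ maxIdeal k M :=
  TwoSidedIdeal.subset_span ⟨i, rfl⟩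

theorem mem_primL_iff {x : NC k M} : x ∈ primL k M ↔ ∀ i, T k M i * x = 0 := by
  refine ⟨fun h i => h _ (T_mem_maxIdeal k M i), fun h y hy => ?_⟩
  -- Nonempty words kill `x`, so every `b` acts on `x` by a scalar, and factors standing to the
  -- right of a generator in an element of the ideal are harmless.
  have key : ∀ b : NC k M, ∃ c : k, b * x = c • x := fun b => by
    induction b using word_induction with
    | word ω =>
      induction ω with
      | nil => exact ⟨1, by simp [word_nil]⟩
      | cons i ω ih =>
        obtain ⟨c, hc⟩ := ih
        exact ⟨0, by rw [word_cons, mul_assoc, hc, mul_smul_comm, h, smul_zero, zero_smul]⟩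
    | add a b ha hb =>
      obtain ⟨c, hc⟩ := ha
      obtain ⟨c', hc'⟩ := hb
      exact ⟨c + c', by rw [add_mul, hc, hc', add_smul]⟩
    | smul c a ha =>
      obtain ⟨c', hc'⟩ := ha
      exact ⟨c * c', by rw [smul_mul_assoc, hc', mul_smul]⟩
  -- The extra factor `b` makes the induction pass through right multiples in the ideal.
  suffices hall : ∀ b, y * (b * x) = 0 by simpa using hall 1
  induction hy using TwoSidedIdeal.span_induction with
  | mem y hy =>
    obtain ⟨i, rfl⟩ := hy
    intro b
    obtain ⟨c, hc⟩ := key b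
    rw [hc, mul_smul_comm, h, smul_zero]
  | zero => simp
  | add y z _ _ hy hz => intro b; rw [add_mul, hy, hz, add_zero]
  | neg y _ hy => intro b; exact (neg_mul y (b * x)).trans (by rw [hy, neg_zero])
  | left_absorb a y _ hy => intro b; rw [mul_assoc, hy, mul_zero]
  | right_absorb a y _ hy => intro b; rw [mul_assoc, ← mul_assoc a, hy]

/-! ### The anti-involution -/

variable {k M}

namespace IsAntiInvolution

variable {θ : NC k M →ₗ[k] NC k M} (hθ : IsAntiInvolution k M θ)
include hθ

theorem map_word (ω : List I) : θ (word k M ω) = word k M ω.reverse := by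
  induction ω with
  | nil => exact hθ.map_one
  | cons i ω ih =>
    rw [word_cons, hθ.map_mul, ih, hθ.map_T, List.reverse_cons, word_append, word_cons, word_nil,
      mul_one]

theorem map_mem_primR {x : NC k M} (hx : x ∈ primL k M) : θ x ∈ primR k M := by
  have h := (mem_primL_iff k M).1 hx
  have key : ∀ y : NC k M, y ∈ maxIdeal k M → θ y ∈ maxIdeal k M := fun y hy => by
    induction hy using TwoSidedIdeal.span_induction with
    | mem y hy => obtain ⟨i, rfl⟩ := hy; rw [hθ.map_T]; exact T_mem_maxIdeal k M i
    | zero => rw [map_zero]; exact TwoSidedIdeal.zero_mem _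
    | add y z _ _ hy hz => rw [map_add]; exact TwoSidedIdeal.add_mem _ hy hz
    | neg y _ hy => rw [map_neg]; exact TwoSidedIdeal.neg_mem _ hy
    | left_absorb a y _ hy => rw [hθ.map_mul]; exact TwoSidedIdeal.mul_mem_right _ _ _ hy
    | right_absorb a y _ hy => rw [hθ.map_mul]; exact TwoSidedIdeal.mul_mem_left _ _ _ hy
  intro y hy
  rw [← hθ.involutive y, ← hθ.map_mul, hx _ (key y hy), map_zero]

theorem map_mem_primL {x : NC k M} (hx : x ∈ primR k M) : θ x ∈ primL k M := by
  rw [mem_primL_iff]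
  intro i
  rw [← hθ.map_T i, ← hθ.map_mul, hx _ (T_mem_maxIdeal k M i), map_zero]

theorem map_primL : (primL k M).map θ = primR k M := by
  ext x
  refine ⟨?_, fun hx => ⟨θ x, hθ.map_mem_primL hx, hθ.involutive x⟩⟩
  rintro ⟨y, hy, rfl⟩
  exact hθ.map_mem_primR hy

theorem map_primR : (primR k M).map θ = primL k M := by
  ext x
  refine ⟨?_, fun hx => ⟨θ x, hθ.map_mem_primR hx, hθ.involutive x⟩⟩
  rintro ⟨y, hy, rfl⟩
  exact hθ.map_mem_primL hy

theorem map_prim : (prim k M).map θ = prim k M := by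
  ext x
  constructor
  · rintro ⟨y, hy, rfl⟩
    exact ⟨hθ.map_mem_primL hy.2, hθ.map_mem_primR hy.1⟩
  · intro hx
    exact ⟨θ x, ⟨hθ.map_mem_primL hx.2, hθ.map_mem_primR hx.1⟩, hθ.involutive x⟩

theorem primR_eq_span {s : Set (NC k M)} (h : primL k M = Submodule.span k s)
    (hs : ∀ x ∈ s, θ x = x) : primR k M = Submodule.span k s := by
  rw [← hθ.map_primL, h, Submodule.map_span]
  congr 1
  exact (Set.image_congr hs).trans (Set.image_id _)

end IsAntiInvolution

theorem apply_eq_self_of_mem_span {θ : NC k M →ₗ[k] NC k M} {s : Set (NC k M)} (hs : ∀ x ∈ s, θ x = x) {x : NC k M}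
    (hx : x ∈ Submodule.span k s) : θ x = x := by
  induction hx using Submodule.span_induction with
  | mem x h => exact hs x h
  | zero => exact map_zero θ
  | add x y _ _ hx hy => rw [map_add, hx, hy]
  | smul c x _ hx => rw [map_smul, hx]

/-- An alternating word of odd length is a palindrome, and reversal of one of even length exchanges
its two letters. Hence the braid relations are stable under reversal, which is what a lift to the
opposite algebra needs. -/
theorem reverse_alternatingWord (i j : I) (a : ℕ) :
    (CoxeterSystem.alternatingWord i j a).reverse =
      if Even a then CoxeterSystem.alternatingWord j i a
      else CoxeterSystem.alternatingWord i j a := by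
  induction a generalizing i j with
  | zero => simp [CoxeterSystem.alternatingWord]
  | succ a ih =>
    have h1 : (CoxeterSystem.alternatingWord i j (a + 1)).reverse =
        (CoxeterSystem.alternatingWord i j a).reverse ++ [if Even a then j else i] := by
      rw [CoxeterSystem.alternatingWord_succ', List.reverse_cons]
    rw [h1, ih]
    by_cases h : Even a <;>
      simp [h, Nat.even_add_one, CoxeterSystem.alternatingWord_succ, List.concat_eq_append]

variable (k M)

theorem exists_isAntiInvolution : ∃ θ : NC k M →ₗ[k] NC k M, IsAntiInvolution k M θ := by
  have hprod : ∀ ω : List I,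
      (ω.map fun i => MulOpposite.op (T k M i)).prod = MulOpposite.op (word k M ω.reverse) := by
    intro ω
    induction ω with
    | nil => simp [word_nil]
    | cons i ω ih =>
      rw [List.map_cons, List.prod_cons, ih, List.reverse_cons, word_append, word_cons, word_nil,
        mul_one, MulOpposite.op_mul]
  let φ : NC k M →ₐ[k] (NC k M)ᵐᵒᵖ := NC.lift k M (fun i => MulOpposite.op (T k M i))
    (fun i j a hij ha => by
      rw [hprod, hprod, reverse_alternatingWord, reverse_alternatingWord]
      have := word_alternatingWord k M i j a hij ha
      split_ifs <;> simp [this])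
    (fun i => by rw [← MulOpposite.op_pow, T_pow_eq_zero, MulOpposite.op_zero])
  let θ : NC k M →ₗ[k] NC k M :=
    (MulOpposite.opLinearEquiv k).symm.toLinearMap ∘ₗ φ.toLinearMap
  have hT : ∀ i, θ (T k M i) = T k M i := fun i => by
    simp [θ, φ, NC.lift_T]
  have hmul : ∀ x y, θ (x * y) = θ y * θ x := fun x y => by simp [θ]
  have hone : θ 1 = 1 := by simp [θ]
  have hword : ∀ ω, θ (word k M ω) = word k M ω.reverse := fun ω => by
    induction ω with
    | nil => exact hone
    | cons i ω ih =>
      rw [word_cons, hmul, ih, hT, List.reverse_cons, word_append, word_cons, word_nil, mul_one]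
  refine ⟨θ, hone, hmul, fun x => ?_, hT⟩
  induction x using word_induction with
  | word ω => rw [hword, hword, List.reverse_reverse]
  | add x y hx hy => rw [map_add, map_add, hx, hy]
  | smul c x hx => rw [map_smul, map_smul, hx]

/-! ### The grading by length -/

open Polynomial in
-- The relations are homogeneous, so `T_i ↦ T_i X` extends to a homomorphism into polynomials over
-- `NC(M)`. It sends a word to itself times `X` to its length, and a nonzero coefficient determines
-- the degree.
theorem length_eq_of_word_eq {ω ω' : List I} (h : word k M ω = word k M ω')
    (h0 : word k M ω ≠ 0) : ω'.length = ω.length := by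
  have hprod : ∀ ω : List I, (ω.map fun i => C (T k M i) * (X : (NC k M)[X])).prod =
      C (word k M ω) * X ^ ω.length := by
    intro ω
    induction ω with
    | nil => simp [word_nil]
    | cons i ω ih =>
      rw [List.map_cons, List.prod_cons, ih, word_cons, C_mul, List.length_cons, pow_succ',
        mul_assoc, mul_assoc, ← mul_assoc X, X_mul_C, mul_assoc]
  let φ : NC k M →ₐ[k] (NC k M)[X] := NC.lift k M (fun i => C (T k M i) * X)
    (fun i j a hij ha => by
      rw [hprod, hprod, word_alternatingWord k M i j a hij ha,
        CoxeterSystem.length_alternatingWord, CoxeterSystem.length_alternatingWord])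
    (fun i => by
      rw [(Polynomial.commute_X (C (T k M i))).symm.mul_pow, ← C_pow, T_pow_eq_zero, C_0, zero_mul])
  have hφ : ∀ ω, φ (word k M ω) = C (word k M ω) * X ^ ω.length := fun ω => by
    rw [← hprod]; exact NC.lift_word _ _ _ _ _ ω
  have h1 := hφ ω
  rw [h, hφ ω', ← h] at h1
  by_contra hne
  have h2 := congrArg (fun p => p.coeff ω'.length) h1
  simp only [coeff_C_mul, coeff_X_pow, if_true, mul_one, if_neg hne, mul_zero] at h2
  exact h0 h2

theorem wordLength_word {ω : List I} (h0 : word k M ω ≠ 0) :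
    wordLength (T k M) (word k M ω) = ω.length := by
  have : {l | ∃ ω' : List I, (ω'.map (T k M)).prod = word k M ω ∧ ω'.length = l} = {ω.length} := by
    ext l
    constructor
    · rintro ⟨ω', h, rfl⟩
      exact length_eq_of_word_eq k M (ω := ω) (ω' := ω') h.symm h0
    · rintro rfl
      exact ⟨ω, rfl, rfl⟩
  rw [wordLength, this, csInf_singleton]

theorem IsAntiInvolution.wordLength_map {θ : NC k M →ₗ[k] NC k M} (hθ : IsAntiInvolution k M θ)
    {ω : List I} (h0 : word k M ω ≠ 0) :
    wordLength (T k M) (word k M ω) = ω.length ∧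
      (∃ ω' : List I, word k M ω' = θ (word k M ω)) ∧
      wordLength (T k M) (θ (word k M ω)) = wordLength (T k M) (word k M ω) := by
  have h1 : word k M ω.reverse ≠ 0 := fun h => by
    rw [← hθ.map_word] at h
    apply h0
    rw [← hθ.involutive (word k M ω), h, map_zero]
  refine ⟨wordLength_word k M h0, ⟨ω.reverse, (hθ.map_word ω).symm⟩, ?_⟩
  rw [hθ.map_word, wordLength_word k M h1, wordLength_word k M h0, List.length_reverse]

end Basics

end GenCoxeterMatrix

/-! ### Monomial modules -/

section PartialActions

variable {I X : Type*}

/-- The composite of the partial maps `act i`, for `i` in the word `ω`, from right to left. -/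
def actWord (act : I → X → Option X) (ω : List I) (x : X) : Option X :=
  ω.foldr (fun i o => o.bind (act i)) (some x)

theorem actWord_nil (act : I → X → Option X) (x : X) : actWord act [] x = some x := rfl

theorem actWord_cons (act : I → X → Option X) (i : I) (ω : List I) (x : X) :
    actWord act (i :: ω) x = (actWord act ω x).bind (act i) := rfl

variable (k : Type*) [CommRing k]

/-- The basis vector of an element, or zero if there is none. -/
noncomputable def optSingle (o : Option X) : X →₀ k := o.elim 0 fun y => Finsupp.single y 1

/-- The linear endomorphism of the free module on `X` given by a partial map. -/
noncomputable def partialEnd (p : X → Option X) : Module.End k (X →₀ k) :=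
  Finsupp.linearCombination k fun x => optSingle k (p x)

theorem partialEnd_single (p : X → Option X) (x : X) :
    partialEnd k p (Finsupp.single x 1) = optSingle k (p x) := by
  simp [partialEnd]

theorem partialEnd_optSingle (p : X → Option X) (o : Option X) :
    partialEnd k p (optSingle k o) = optSingle k (o.bind p) := by
  cases o with
  | none => exact map_zero _
  | some x => exact partialEnd_single k p x

theorem prod_partialEnd_single (act : I → X → Option X) (ω : List I) (x : X) :
    (ω.map fun i => partialEnd k (act i)).prod (Finsupp.single x 1) =
      optSingle k (actWord act ω x) := by
  induction ω with
  | nil => rfl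
  | cons i ω ih =>
    rw [List.map_cons, List.prod_cons, Module.End.mul_apply, ih, partialEnd_optSingle,
      actWord_cons]

/-- By injectivity on `V`, which contains the support of `c`, only `x` contributes to the
coefficient at `z`. -/
theorem partialEnd_apply_eq {V : Set X} {p : X → Option X}
    (hinj : ∀ x ∈ V, ∀ y ∈ V, ∀ z, p x = some z → p y = some z → x = y)
    {c : X →₀ k} (hc : ∀ x, c x ≠ 0 → x ∈ V) {x z : X} (hx : x ∈ V) (hz : p x = some z) :
    partialEnd k p c z = c x := by
  classical
  rw [partialEnd, Finsupp.linearCombination_apply, Finsupp.sum, Finsupp.finsetSum_apply,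
    Finset.sum_eq_single x]
  · simp [optSingle, hz]
  · intro y hy hyx
    cases hpy : p y with
    | none => simp [optSingle]
    | some w =>
      have hw : w ≠ z := by
        rintro rfl
        exact hyx (hinj y (hc y (Finsupp.mem_support_iff.1 hy)) x hx w hpy hz)
      simp [optSingle, Finsupp.single_eq_of_ne hw.symm]
  · intro h
    simp [Finsupp.notMem_support_iff.1 h]

end PartialActions

/-! ### Bases of `NC(M)` on which the generators act by partial injections. -/

namespace GenCoxeterMatrix

/-- Partial maps `act i` satisfying the relations of `NC(M)`, an initial element `base`, and
elements `nf x` of `NC(M)`, for `x` in a set `V` of admissible elements, on which the generators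
act through `act`. -/
structure NormalForm (k : Type*) [CommRing k] {I : Type*} (M : GenCoxeterMatrix I)
    (X : Type*) where
  act : I → X → Option X
  V : Set X
  base : X
  nf : X → NC k M
  braid : ∀ (i j : I) (a : ℕ), i ≠ j → M.m i j = a → ∀ x,
    actWord act (CoxeterSystem.alternatingWord i j a) x =
      actWord act (CoxeterSystem.alternatingWord j i a) x
  order : ∀ i x, actWord act (List.replicate (M.m i i).toNat i) x = none
  base_mem : base ∈ V
  nf_base : nf base = 1
  act_mem : ∀ i, ∀ x ∈ V, ∀ y, act i x = some y → y ∈ V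
  act_inj : ∀ i, ∀ x ∈ V, ∀ y ∈ V, ∀ z, act i x = some z → act i y = some z → x = y
  T_mul_nf : ∀ i, ∀ x ∈ V, T k M i * nf x = (act i x).elim 0 nf
  reach : ∀ x ∈ V, ∃ ω, actWord act ω base = some x

namespace NormalForm

variable {k : Type*} [CommRing k] {I : Type*} {M : GenCoxeterMatrix I} {X : Type*}
  (N : NormalForm k M X)

/-- The representation of `NC(M)` on the free module on `X`. -/
noncomputable def rep : NC k M →ₐ[k] Module.End k (X →₀ k) :=
  NC.lift k M (fun i => partialEnd k (N.act i))
    (fun i j a hij ha => by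
      refine Finsupp.lhom_ext' fun x => LinearMap.ext_ring ?_
      simp only [LinearMap.comp_apply, Finsupp.lsingle_apply]
      rw [prod_partialEnd_single, prod_partialEnd_single, N.braid i j a hij ha x])
    (fun i => by
      refine Finsupp.lhom_ext' fun x => LinearMap.ext_ring ?_
      simp only [LinearMap.comp_apply, Finsupp.lsingle_apply]
      rw [← List.prod_replicate, ← List.map_replicate (f := fun i => partialEnd k (N.act i)),
        prod_partialEnd_single, N.order]
      rfl)

/-- The coordinates of an element of `NC(M)`. -/
noncomputable def coord : NC k M →ₗ[k] X →₀ k :=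
  (LinearMap.applyₗ (Finsupp.single N.base 1)).comp N.rep.toLinearMap

theorem coord_T_mul (i : I) (a : NC k M) :
    N.coord (T k M i * a) = partialEnd k (N.act i) (N.coord a) := by
  simp [coord, rep, NC.lift_T]

theorem coord_word (ω : List I) :
    N.coord (word k M ω) = optSingle k (actWord N.act ω N.base) := by
  simp only [coord, rep, LinearMap.comp_apply, AlgHom.toLinearMap_apply, NC.lift_word]
  exact prod_partialEnd_single k N.act ω N.base

theorem actWord_mem {x : X} (hx : x ∈ N.V) (ω : List I) {y : X}
    (h : actWord N.act ω x = some y) : y ∈ N.V := by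
  induction ω generalizing y with
  | nil => exact (Option.some.inj h) ▸ hx
  | cons i ω ih =>
    rw [actWord_cons] at h
    obtain ⟨z, hz, hy⟩ := Option.bind_eq_some_iff.1 h
    exact N.act_mem i z (ih hz) y hy

theorem word_mul_nf (ω : List I) {x : X} (hx : x ∈ N.V) :
    word k M ω * N.nf x = (actWord N.act ω x).elim 0 N.nf := by
  induction ω with
  | nil => rw [word_nil, one_mul]; rfl
  | cons i ω ih =>
    rw [word_cons, mul_assoc, ih, actWord_cons]
    cases h : actWord N.act ω x with
    | none => exact mul_zero _
    | some y => exact N.T_mul_nf i y (N.actWord_mem hx ω h)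

theorem word_eq (ω : List I) : word k M ω = (actWord N.act ω N.base).elim 0 N.nf := by
  rw [← N.word_mul_nf ω N.base_mem, N.nf_base, mul_one]

/-- A word leading from the base to `x` equals `nf x` in the algebra, while its coordinates are
computed by the partial action. -/
theorem coord_nf {x : X} (hx : x ∈ N.V) : N.coord (N.nf x) = Finsupp.single x 1 := by
  obtain ⟨ω, h⟩ := N.reach x hx
  have := N.word_eq ω
  rw [h] at this
  exact (congrArg N.coord this).symm.trans (by rw [coord_word, h]; rfl)

theorem linearIndepOn : LinearIndepOn k N.nf N.V := by
  have h : LinearIndependent k fun x : N.V => Finsupp.single (x : X) (1 : k) :=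
    (Finsupp.linearIndependent_single_one k X).comp _ Subtype.val_injective
  refine LinearIndependent.of_comp N.coord ?_
  convert h with x
  exact N.coord_nf x.2

theorem eq_linearCombination (a : NC k M) :
    a = Finsupp.linearCombination k N.nf (N.coord a) ∧ ∀ x, N.coord a x ≠ 0 → x ∈ N.V := by
  induction a using word_induction with
  | word ω =>
    rw [coord_word]
    have h := N.word_eq ω
    cases hx : actWord N.act ω N.base with
    | none => rw [hx] at h; simpa [optSingle] using h
    | some x =>
      rw [hx] at h
      refine ⟨by simpa [optSingle] using h, fun y hy => ?_⟩
      have : y = x := by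
        by_contra hyx
        exact hy (by simp [optSingle, Finsupp.single_eq_of_ne hyx])
      rw [this]
      exact N.actWord_mem N.base_mem ω hx
  | add a b ha hb =>
    refine ⟨by rw [map_add, map_add, ← ha.1, ← hb.1], fun x hx => ?_⟩
    rw [map_add, Finsupp.add_apply] at hx
    by_cases h : N.coord a x = 0
    · rw [h, zero_add] at hx; exact hb.2 x hx
    · exact ha.2 x h
  | smul c a ha =>
    refine ⟨by rw [map_smul, map_smul, ← ha.1], fun x hx => ha.2 x fun h => hx ?_⟩
    rw [map_smul, Finsupp.smul_apply, h, smul_zero]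

/-- The left-primitive elements are spanned by the normal forms killed by all generators. -/
theorem primL_eq : primL k M = Submodule.span k (N.nf '' {x ∈ N.V | ∀ i, N.act i x = none}) := by
  apply le_antisymm
  · intro a ha
    rw [mem_primL_iff] at ha
    obtain ⟨h1, h2⟩ := N.eq_linearCombination a
    rw [Finsupp.mem_span_image_iff_linearCombination]
    refine ⟨N.coord a, ?_, h1.symm⟩
    rw [Finsupp.mem_supported]
    intro x hx
    have hx0 := Finsupp.mem_support_iff.1 hx
    refine ⟨h2 x hx0, fun i => ?_⟩
    cases hz : N.act i x with
    | none => rfl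
    | some z =>
      exfalso
      apply hx0
      -- The coefficient of `a` at `x` reappears as the coefficient of `T_i a = 0` at `z`.
      rw [← partialEnd_apply_eq k (N.act_inj i) h2 (h2 x hx0) hz, ← coord_T_mul, ha i, map_zero,
        Finsupp.zero_apply]
  · rw [Submodule.span_le]
    rintro _ ⟨x, ⟨hx, hd⟩, rfl⟩
    refine (mem_primL_iff k M).2 fun i => ?_
    rw [N.T_mul_nf i x hx, hd i]
    rfl

end NormalForm

end GenCoxeterMatrix

/-! ### Coxeter groups: strong exchange -/

namespace CoxeterSystem

open List

variable {B W : Type*} [Group W] {M : CoxeterMatrix B} (cs : CoxeterSystem M W)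

section Parity

/-- The permutation of `W × ZMod 2` attached to a simple reflection, which records the parity of
the number of occurrences of an element in a right inversion sequence. -/
noncomputable def parityPerm [DecidableEq W] (i : B) : Equiv.Perm (W × ZMod 2) :=
  Function.Involutive.toPerm
    (fun p => (cs.simple i * p.1 * cs.simple i, p.2 + if p.1 = cs.simple i then 1 else 0))
    (by
      rintro ⟨t, e⟩
      have h : cs.simple i * t * cs.simple i = cs.simple i ↔ t = cs.simple i := by
        rw [mul_eq_right, mul_eq_one_iff_inv_eq, inv_simple, eq_comm]
      simp only [h, Prod.mk.injEq]
      refine ⟨by simp [mul_assoc], ?_⟩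
      split_ifs
      · rw [add_assoc, CharTwo.add_self_eq_zero, add_zero]
      · simp)

theorem parityPerm_apply [DecidableEq W] (i : B) (p : W × ZMod 2) :
    cs.parityPerm i p =
      (cs.simple i * p.1 * cs.simple i, p.2 + if p.1 = cs.simple i then 1 else 0) := rfl

/-- A new letter `i` flips the sign exactly when `t`, conjugated by the product of `ω`, is `s_i`.
Equivalently, `t` is the entry that `i` adds to the inversion sequence. -/
theorem prod_parityPerm [DecidableEq W] (ω : List B) (t : W) (e : ZMod 2) :
    (ω.map cs.parityPerm).prod (t, e) =
      (cs.wordProd ω * t * (cs.wordProd ω)⁻¹, e + (cs.rightInvSeq ω).count t) := by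
  induction ω with
  | nil => simp
  | cons i ω ih =>
    rw [map_cons, prod_cons, Equiv.Perm.mul_apply, ih, parityPerm_apply]
    have h : cs.wordProd ω * t * (cs.wordProd ω)⁻¹ = cs.simple i ↔
        (cs.wordProd ω)⁻¹ * cs.simple i * cs.wordProd ω = t := by
      constructor <;> intro h <;> [rw [← h]; rw [← h]] <;> group
    simp only [wordProd_cons, mul_inv_rev, inv_simple, rightInvSeq, List.count_cons, h, beq_iff_eq,
      Prod.mk.injEq]
    refine ⟨by simp only [mul_assoc], ?_⟩
    split_ifs <;> push_cast <;> ring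

theorem rightInvSeq_alternatingWord (i j : B) (m : ℕ) :
    cs.rightInvSeq (alternatingWord i j m) =
      ((List.range m).map fun p => cs.simple j * (cs.simple i * cs.simple j) ^ p).reverse := by
  induction m generalizing i j with
  | zero => simp [alternatingWord]
  | succ m ih =>
    rw [alternatingWord_succ, rightInvSeq_concat, concat_eq_append, ih, List.range_succ_eq_map,
      map_cons, reverse_cons, map_reverse, map_map, map_map, pow_zero, mul_one]
    congr 2
    refine map_congr_left fun p hp => ?_
    clear hp
    simp only [Function.comp_apply, MulAut.conj_apply, inv_simple]
    rw [mul_assoc, mul_assoc]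
    congr 1
    induction p with
    | zero => simp
    | succ p ihp => rw [pow_succ', pow_succ', ← ihp]; simp only [mul_assoc]

theorem mem_rightInvSeq_alternatingWord {i j : B} {m : ℕ} {t : W} :
    t ∈ cs.rightInvSeq (alternatingWord i j m) ↔
      ∃ p < m, cs.simple j * (cs.simple i * cs.simple j) ^ p = t := by
  simp [rightInvSeq_alternatingWord]

theorem rightInvSeq_append (ω ω' : List B) :
    cs.rightInvSeq (ω ++ ω') =
      (cs.rightInvSeq ω).map (MulAut.conj (cs.wordProd ω')⁻¹) ++ cs.rightInvSeq ω' := by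
  induction ω with
  | nil => simp
  | cons i ω ih =>
    rw [cons_append, rightInvSeq, ih, rightInvSeq, map_cons, cons_append, wordProd_append]
    congr 1
    simp only [MulAut.conj_apply, mul_inv_rev, inv_inv, mul_assoc]

theorem prod_map_alternatingWord_two_mul {G : Type*} [Monoid G] (f : B → G) (i j : B) (m : ℕ) :
    ((alternatingWord i j (2 * m)).map f).prod = (f i * f j) ^ m := by
  induction m with
  | zero => simp [alternatingWord]
  | succ m ih =>
    rw [Nat.mul_succ, alternatingWord_succ, alternatingWord_succ, concat_eq_append,
      concat_eq_append, map_append, map_append, prod_append, prod_append, ih, pow_succ]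
    simp [mul_assoc]

/-- The word `(ij)^m` with `m = M i j` has product `1`. Its inversion sequence runs twice through
the same `m` elements, because `(s_i s_j)^m = 1`, so all counts are even. -/
theorem isLiftable_parityPerm [DecidableEq W] : M.IsLiftable cs.parityPerm := by
  intro i j
  rw [← prod_map_alternatingWord_two_mul]
  ext1 ⟨t, e⟩
  have h1 : cs.wordProd (alternatingWord i j (2 * M i j)) = 1 := by
    rw [wordProd, prod_map_alternatingWord_two_mul, simple_mul_simple_pow]
  rw [prod_parityPerm, h1, rightInvSeq_alternatingWord, count_reverse, two_mul, range_add,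
    map_append, map_map, count_append]
  have h2 : ((fun p => cs.simple j * (cs.simple i * cs.simple j) ^ p) ∘ fun x => M i j + x) =
      fun p => cs.simple j * (cs.simple i * cs.simple j) ^ p := by
    funext p
    simp [pow_add]
  rw [h2, Nat.cast_add, CharTwo.add_self_eq_zero]
  simp

/-- The parity of the number of occurrences of an element in the right inversion sequence depends
only on the product of the word. -/
theorem natCast_count_rightInvSeq_eq [DecidableEq W] {ω ω' : List B}
    (h : cs.wordProd ω = cs.wordProd ω') (t : W) :
    ((cs.rightInvSeq ω).count t : ZMod 2) = (cs.rightInvSeq ω').count t := by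
  have key : ∀ ω : List B, cs.lift ⟨_, cs.isLiftable_parityPerm⟩ (cs.wordProd ω) =
      (ω.map cs.parityPerm).prod := fun ω => by
    rw [wordProd, map_list_prod, map_map]
    congr 1
    exact map_congr_left fun i _ => cs.lift_apply_simple _ i
  have h1 := (key ω).symm.trans ((congrArg _ h).trans (key ω'))
  have h2 := congrArg (fun p : Equiv.Perm (W × ZMod 2) => (p (t, 0)).2) h1
  simpa [prod_parityPerm] using h2

end Parity

/-- The exchange property. -/
theorem IsRightDescent.mem_rightInvSeq {ω : List B} {i : B}
    (h : cs.IsRightDescent (cs.wordProd ω) i) : cs.simple i ∈ cs.rightInvSeq ω := by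
  classical
  -- A reduced word of the same element that ends in `i` has `s_i` exactly once in its inversion
  -- sequence; by parity, `s_i` occurs in that of `ω` too.
  obtain ⟨ω', hω', he⟩ := cs.exists_isReduced (cs.wordProd ω * cs.simple i)
  have hw : cs.wordProd (ω'.concat i) = cs.wordProd ω := by
    rw [wordProd_concat, ← he, simple_mul_simple_cancel_right]
  have hred : cs.IsReduced (ω'.concat i) := by
    rw [IsReduced, hw, length_concat, ← hω', ← he]
    exact ((cs.isRightDescent_iff).1 h).symm
  have hcount : (cs.rightInvSeq (ω'.concat i)).count (cs.simple i) = 1 := by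
    refine count_eq_one_of_mem hred.nodup_rightInvSeq ?_
    rw [rightInvSeq_concat]
    simp
  have := cs.natCast_count_rightInvSeq_eq hw (cs.simple i)
  rw [hcount] at this
  by_contra hn
  rw [count_eq_zero_of_not_mem hn] at this
  exact absurd this (by decide)

theorem IsRightDescent.exists_eraseIdx {ω : List B} {i : B}
    (h : cs.IsRightDescent (cs.wordProd ω) i) : ∃ p < ω.length,
      (cs.rightInvSeq ω)[p]? = some (cs.simple i) ∧
      cs.wordProd ω * cs.simple i = cs.wordProd (ω.eraseIdx p) := by
  obtain ⟨p, hp, he⟩ := mem_iff_getElem.1 (h.mem_rightInvSeq)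
  refine ⟨p, by simpa using hp, by rw [getElem?_eq_getElem hp, he], ?_⟩
  rw [← wordProd_mul_getD_rightInvSeq, getD_eq_getElem _ _ hp, he]

end CoxeterSystem

/-! ### Coxeter groups: the geometric representation -/

namespace CoxeterMatrix

open Real Polynomial.Chebyshev

variable {B : Type*} (M : CoxeterMatrix B)

/-- The coroot attached to a simple root, with value `-2 cos (π / M i j)` at the `j`-th root. -/
noncomputable def coroot (i : B) : Module.Dual ℝ (B →₀ ℝ) :=
  Finsupp.linearCombination ℝ fun j => -2 * cos (π / M i j)

theorem coroot_single (i j : B) :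
    M.coroot i (Finsupp.single j 1) = -2 * cos (π / M i j) := by
  simp [coroot]

theorem coroot_self (i : B) : M.coroot i (Finsupp.single i 1) = 2 := by
  simp [coroot_single]

/-- The reflection of the geometric representation attached to a simple root. -/
noncomputable def geomReflection (i : B) : (B →₀ ℝ) ≃ₗ[ℝ] (B →₀ ℝ) :=
  Module.reflection (M.coroot_self i)

theorem coroot_mul_coroot_sub_two (i j : B) :
    M.coroot i (Finsupp.single j 1) * M.coroot j (Finsupp.single i 1) - 2 =
      2 * cos (2 * (π / M i j)) := by
  rw [coroot_single, coroot_single, M.symmetric j i, cos_two_mul]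
  ring

theorem sin_two_mul_pi_div_ne_zero {m : ℕ} (hm : 3 ≤ m) : sin (2 * (π / m)) ≠ 0 := by
  have hm' : (3 : ℝ) ≤ m := by exact_mod_cast hm
  have hpos : 0 < π / m := div_pos pi_pos (by linarith)
  refine (sin_pos_of_pos_of_lt_pi (by linarith) ?_).ne'
  rw [← mul_div_assoc, div_lt_iff₀ (by linarith)]
  nlinarith [pi_pos]

theorem S_two_mul_cos {θ : ℝ} (h : sin θ ≠ 0) (n : ℤ) :
    (S ℝ n).eval (2 * cos θ) = sin ((n + 1) * θ) / sin θ := by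
  rw [eq_div_iff h, S_two_mul_real_cos]

/-- Powers of a product of two reflections are given by Chebyshev polynomials `S` at `2 cos (2π/m)`,
where `S_n(2 cos x) = sin ((n+1)x) / sin x`. For exponent `m` the relevant factor is zero: a single
value of `S` for even `m`, the sum of two consecutive values for odd `m`. -/
theorem isLiftable_geomReflection : M.IsLiftable M.geomReflection := by
  intro i j
  by_cases hij : i = j
  · subst hij
    rw [M.diagonal, pow_one]
    ext1 v
    exact Module.involutive_reflection (M.coroot_self i) v
  obtain h0 | h0 := eq_or_ne (M i j) 0
  · rw [h0, pow_zero]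
  have h1 := M.off_diagonal i j hij
  ext1 v
  rw [geomReflection, geomReflection,
    Module.reflection_mul_reflection_pow_apply _ _ _ _ _ (M.coroot_mul_coroot_sub_two i j).symm]
  -- For `m = 2` the angle is `π`, whose sine vanishes, so the quotient formula is unavailable and
  -- the values are computed directly.
  obtain h2 | h2 : M i j = 2 ∨ 3 ≤ M i j := by omega
  · rw [coroot_single, coroot_single, M.symmetric j i, h2]
    simp only [Nat.cast_ofNat, sub_self, EuclideanDomain.zero_div]
    rw [show ((2 : ℤ) - 1) / 2 = 0 by norm_num, show ((2 : ℤ) - 3) / 2 = -1 by norm_num,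
      show (2 : ℤ) / 2 = 1 by norm_num, S_zero, S_neg_one, S_one,
      show 2 * (π / 2) = π by ring]
    simp only [cos_pi_div_two, cos_pi, Polynomial.eval_one, Polynomial.eval_X,
      Polynomial.eval_zero, LinearEquiv.coe_one, id_eq]
    module
  · have hs := sin_two_mul_pi_div_ne_zero h2
    have hm : (M i j : ℝ) ≠ 0 := by exact_mod_cast h0
    obtain ⟨q, hq | hq⟩ := Nat.even_or_odd' (M i j)
    · have e1 : ((M i j : ℤ) - 2) / 2 = q - 1 := by omega
      have e2 : ((M i j : ℤ) - 1) / 2 = q - 1 := by omega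
      have h3 : (S ℝ (q - 1)).eval (2 * cos (2 * (π / M i j))) = 0 := by
        rw [S_two_mul_cos hs]
        have : ((((q : ℤ) - 1 : ℤ) : ℝ) + 1) * (2 * (π / M i j)) = π := by
          have : (M i j : ℝ) = 2 * q := by exact_mod_cast hq
          push_cast
          field_simp
          rw [this]
          ring
        rw [this, sin_pi, zero_div]
      rw [e1, e2, h3]
      simp
    · have e1 : ((M i j : ℤ) - 2) / 2 = q - 1 := by omega
      have e2 : ((M i j : ℤ) - 1) / 2 = q := by omega
      have e3 : ((M i j : ℤ) - 3) / 2 = q - 1 := by omega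
      have e4 : (M i j : ℤ) / 2 = q := by omega
      have h3 : (S ℝ q).eval (2 * cos (2 * (π / M i j))) +
          (S ℝ (q - 1)).eval (2 * cos (2 * (π / M i j))) = 0 := by
        rw [S_two_mul_cos hs, S_two_mul_cos hs]
        have hq' : (M i j : ℝ) = 2 * q + 1 := by exact_mod_cast hq
        have a1 : (((q : ℤ) : ℝ) + 1) * (2 * (π / M i j)) = π / M i j + π := by
          push_cast
          field_simp
          rw [hq']
          ring
        have a2 : ((((q : ℤ) - 1 : ℤ) : ℝ) + 1) * (2 * (π / M i j)) = π - π / M i j := by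
          push_cast
          field_simp
          rw [hq']
          ring
        rw [a1, a2, sin_add_pi, sin_pi_sub]
        ring
      rw [e1, e2, e3, e4, h3]
      simp

/-- If the power fixes the `i`-th root and `m ≥ 3`, its `j`-coordinate forces `S_{p-1} = 0`, and
then its `i`-coordinate forces `cos (2πp/m) = 1`, impossible for `0 < p < m`. -/
theorem geomReflection_mul_pow_ne_one {i j : B} (hij : i ≠ j) {p : ℕ} (hp : 0 < p)
    (hpM : M i j = 0 ∨ p < M i j) : (M.geomReflection i * M.geomReflection j) ^ p ≠ 1 := by
  intro h
  have h1 := LinearEquiv.congr_fun h (Finsupp.single i 1)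
  rw [geomReflection, geomReflection, Module.reflection_mul_reflection_pow_apply_self _ _ _ _
    (M.coroot_mul_coroot_sub_two i j).symm] at h1
  have hi := DFunLike.congr_fun h1 i
  have hj := DFunLike.congr_fun h1 j
  simp only [Finsupp.add_apply, Finsupp.smul_apply, Finsupp.single_eq_same, smul_eq_mul, mul_one,
    Finsupp.single_eq_of_ne hij, Finsupp.single_eq_of_ne hij.symm, mul_zero, add_zero, zero_add,
    LinearEquiv.coe_one, id_eq, coroot_single, M.symmetric j i] at hi hj
  have hM1 := M.off_diagonal i j hij
  obtain h0 | h2 | h3 : M i j = 0 ∨ M i j = 2 ∨ 3 ≤ M i j := by omega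
  -- Here `0` encodes `∞`, and `π / 0 = 0` gives the right angle for it: `S_n` is evaluated at `2`,
  -- where it is `n + 1`.
  · rw [h0] at hi hj
    simp only [Nat.cast_zero, div_zero, mul_zero, cos_zero, mul_one, S_eval_two] at hi hj
    have : (0 : ℝ) < p := by exact_mod_cast hp
    push_cast at hi hj
    linarith
  · obtain rfl : p = 1 := by omega
    rw [h2] at hi
    simp only [Nat.cast_one, sub_self, S_one, S_zero, Polynomial.eval_X, Polynomial.eval_one] at hi
    rw [Nat.cast_ofNat, show 2 * (π / 2) = π by ring, cos_pi] at hi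
    norm_num at hi
  · have hs := sin_two_mul_pi_div_ne_zero h3
    have hp' : p < M i j := by omega
    have hm : (3 : ℝ) ≤ M i j := by exact_mod_cast h3
    have hc : cos (π / M i j) ≠ 0 := by
      refine (cos_pos_of_mem_Ioo ⟨?_, ?_⟩).ne'
      · have : 0 < π / M i j := div_pos pi_pos (by linarith)
        linarith [pi_pos]
      · exact div_lt_div_of_pos_left pi_pos (by norm_num) (by linarith)
    have hS : (S ℝ (p - 1)).eval (2 * cos (2 * (π / M i j))) = 0 := by
      have : -(-2 * cos (π / M i j)) ≠ 0 := by simpa using hc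
      exact (mul_eq_zero.1 hj).resolve_right this
    rw [hS, add_zero, S_two_mul_cos hs, div_eq_one_iff_eq hs] at hi
    rw [S_two_mul_cos hs, div_eq_zero_iff, or_iff_left hs] at hS
    push_cast at hi hS
    rw [sub_add_cancel] at hS
    rw [add_mul, one_mul, sin_add, hS, zero_mul, zero_add] at hi
    have h4 : cos (p * (2 * (π / M i j))) = 1 := mul_right_cancel₀ hs (by rw [hi, one_mul])
    have hpos : 0 < p * (2 * (π / M i j)) := by
      have : (0 : ℝ) < p := by exact_mod_cast hp
      have : 0 < π / M i j := div_pos pi_pos (by linarith)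
      positivity
    have hlt : p * (2 * (π / M i j)) < 2 * π := by
      have : (p : ℝ) < M i j := by exact_mod_cast hp'
      rw [← mul_div_assoc, ← mul_div_assoc, div_lt_iff₀ (by linarith)]
      nlinarith [pi_pos]
    rw [cos_eq_one_iff_of_lt_of_lt (by linarith) hlt] at h4
    linarith

end CoxeterMatrix

namespace CoxeterSystem

variable {B W : Type*} [Group W] {M : CoxeterMatrix B} (cs : CoxeterSystem M W)

theorem simple_mul_simple_pow_ne_one {i j : B} (hij : i ≠ j) {p : ℕ} (hp : 0 < p)
    (hpM : M i j = 0 ∨ p < M i j) : (cs.simple i * cs.simple j) ^ p ≠ 1 := by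
  intro h
  apply M.geomReflection_mul_pow_ne_one hij hp hpM
  have := congrArg (cs.lift ⟨_, M.isLiftable_geomReflection⟩) h
  rwa [map_pow, map_mul, lift_apply_simple, lift_apply_simple, map_one] at this

end CoxeterSystem

/-! ### Matsumoto's theorem and the longest element -/

namespace CoxeterSystem

open List

variable {B W : Type*} [Group W] {M : CoxeterMatrix B} (cs : CoxeterSystem M W)

/-- Membership would make `(s_i s_j)^(p+1)` trivial with `p + 1` below the order. In the exchange
argument this prevents the erased letter from lying in the alternating suffix. -/
theorem simple_not_mem_rightInvSeq_alternatingWord {i j : B} (hij : i ≠ j) {m : ℕ}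
    (hm : M i j = 0 ∨ m < M i j) : cs.simple i ∉ cs.rightInvSeq (alternatingWord i j m) := by
  rw [mem_rightInvSeq_alternatingWord]
  rintro ⟨p, hp, h⟩
  apply cs.simple_mul_simple_pow_ne_one hij (p := p + 1) (by omega) (by omega)
  rw [pow_succ', mul_assoc, h, simple_mul_simple_self]

/-- An element with two right descents `i ≠ j` has reduced words ending with every alternating
word in `i` and `j` which is not longer than the braid word. -/
theorem exists_isReduced_append_alternatingWord {i j : B} (hij : i ≠ j) {w : W}
    (hi : cs.IsRightDescent w i) (hj : cs.IsRightDescent w j) (m : ℕ)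
    (hm : M i j = 0 ∨ m ≤ M i j) :
    ∃ u, cs.IsReduced (u ++ alternatingWord i j m) ∧
      cs.wordProd (u ++ alternatingWord i j m) = w := by
  induction m generalizing i j with
  | zero =>
    obtain ⟨ω, h, rfl⟩ := cs.exists_isReduced w
    exact ⟨ω, by simpa [alternatingWord] using h, by simp [alternatingWord]⟩
  | succ m ih =>
    obtain ⟨u, hu, rfl⟩ := ih hij.symm hj hi (by rw [M.symmetric j i]; omega)
    obtain ⟨p, hp, ht, he⟩ := hj.exists_eraseIdx
    have hred := (cs.isRightDescent_iff).1 hj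
    -- The descent `j` erases one letter. If it lies in `u`, appending `j` lengthens the alternating
    -- suffix; otherwise `s_j` would lie in the inversion sequence of that suffix.
    by_cases hpu : p < u.length
    · rw [eraseIdx_append_of_lt_length hpu] at he
      have hw : cs.wordProd (u.eraseIdx p ++ alternatingWord i j (m + 1)) =
          cs.wordProd (u ++ alternatingWord j i m) := by
        rw [alternatingWord_succ, concat_eq_append, ← append_assoc, ← concat_eq_append,
          wordProd_concat, ← he, simple_mul_simple_cancel_right]
      refine ⟨u.eraseIdx p, ?_, hw⟩
      rw [IsReduced, hw, hu.eq, length_append, length_append, length_alternatingWord,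
        length_alternatingWord, ← length_eraseIdx_add_one hpu]
      omega
    · exfalso
      rw [rightInvSeq_append, getElem?_append_right (by simpa using hpu)] at ht
      exact cs.simple_not_mem_rightInvSeq_alternatingWord hij.symm
        (by rw [M.symmetric j i]; omega) (mem_of_getElem? ht)

/-- Matsumoto's theorem: a function on the simple reflections which satisfies the braid relations
has the same product along any two reduced words of an element. -/
theorem prod_map_eq_of_isReduced {G : Type*} [Monoid G] {f : B → G}
    (hf : ∀ i j, i ≠ j → M i j ≠ 0 →
      ((alternatingWord i j (M i j)).map f).prod = ((alternatingWord j i (M i j)).map f).prod)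
    {ω ω' : List B} (hω : cs.IsReduced ω) (hω' : cs.IsReduced ω')
    (h : cs.wordProd ω = cs.wordProd ω') : (ω.map f).prod = (ω'.map f).prod := by
  obtain ⟨n, hn⟩ : ∃ n, ω.length = n := ⟨_, rfl⟩
  have hn' : ω'.length = n := by rw [← hω'.eq, ← h, hω.eq, hn]
  induction n generalizing ω ω' with
  | zero => rw [List.length_eq_zero_iff.1 hn, List.length_eq_zero_iff.1 hn']
  | succ n ih =>
    have same : ∀ {u v : List B} {i : B}, cs.IsReduced (u ++ [i]) → cs.IsReduced (v ++ [i]) →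
        cs.wordProd (u ++ [i]) = cs.wordProd (v ++ [i]) → (u ++ [i]).length = n + 1 →
        ((u ++ [i]).map f).prod = ((v ++ [i]).map f).prod := by
      intro u v i hu hv huv hlen
      have hu' : cs.IsReduced u := by simpa using hu.take u.length
      have hv' : cs.IsReduced v := by simpa using hv.take v.length
      have hlen' : (v ++ [i]).length = n + 1 := by rw [← hv.eq, ← huv, hu.eq, hlen]
      rw [wordProd_append, wordProd_append, mul_left_inj] at huv
      rw [map_append, map_append, prod_append, prod_append,
        ih hu' hv' huv (by simpa using hlen) (by simpa using hlen')]
    obtain ⟨u, i, rfl⟩ := (eq_nil_or_concat' ω).resolve_left (by rintro rfl; simp at hn)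
    obtain ⟨v, j, rfl⟩ := (eq_nil_or_concat' ω').resolve_left (by rintro rfl; simp at hn')
    by_cases hij : i = j
    · subst hij
      exact same hω hω' h hn
    have descent : ∀ {u : List B} {i : B}, cs.IsReduced (u ++ [i]) →
        cs.IsRightDescent (cs.wordProd (u ++ [i])) i := by
      intro u i hu
      rw [IsRightDescent, hu.eq, wordProd_append, wordProd_singleton,
        simple_mul_simple_cancel_right, length_append, length_singleton]
      exact Nat.lt_succ_of_le (cs.length_wordProd_le u)
    have hi := descent hω
    have hj := descent hω'
    rw [← h] at hj
    obtain h0 | h0 := eq_or_ne (M i j) 0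
    -- Without a braid relation the alternating suffix could be longer than the element itself,
    -- whose length is `n + 1`.
    · obtain ⟨x, hx, hxw⟩ := cs.exists_isReduced_append_alternatingWord hij hi hj (n + 2) (Or.inl h0)
      have := hx.eq
      rw [hxw, hω.eq, hn, length_append, length_alternatingWord] at this
      omega
    -- Two intermediate words, `x` followed by either side of the braid relation, end in `j` and `i`
    -- respectively. Each is compared with the given word having the same last letter, by induction
    -- on what precedes it.
    · obtain ⟨x, hx, hxw⟩ :=
        cs.exists_isReduced_append_alternatingWord hij hi hj (M i j) (Or.inr le_rfl)
      obtain ⟨m, hm⟩ : ∃ m, M i j = m + 1 := Nat.exists_eq_succ_of_ne_zero h0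
      have hw : cs.wordProd (x ++ alternatingWord i j (M i j)) =
          cs.wordProd (x ++ alternatingWord j i (M i j)) := by
        rw [wordProd_append, wordProd_append]
        congr 1
        have := cs.wordProd_braidWord_eq i j
        rwa [braidWord, braidWord, M.symmetric j i] at this
      have hx' : cs.IsReduced (x ++ alternatingWord j i (M i j)) := by
        rw [IsReduced, ← hw, hx.eq]
        simp
      have e1 : x ++ alternatingWord i j (M i j) = x ++ alternatingWord j i m ++ [j] := by
        rw [hm, alternatingWord_succ, concat_eq_append, append_assoc]
      have e2 : x ++ alternatingWord j i (M i j) = x ++ alternatingWord i j m ++ [i] := by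
        rw [hm, alternatingWord_succ, concat_eq_append, append_assoc]
      calc ((u ++ [i]).map f).prod = ((x ++ alternatingWord j i (M i j)).map f).prod := by
            rw [e2]
            exact same hω (e2 ▸ hx') (by rw [← e2, ← hw, hxw]) hn
        _ = ((x ++ alternatingWord i j (M i j)).map f).prod := by
            rw [map_append, map_append, prod_append, prod_append, hf i j hij h0]
        _ = ((v ++ [j]).map f).prod := by
            rw [e1]
            refine same (e1 ▸ hx) hω' (by rw [← e1, hxw, h]) ?_
            rw [← e1, ← hx.eq, hxw, hω.eq, hn]

/-- An element with all simple reflections as right descents is the longest one. -/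
theorem length_mul_inv_add_length {w : W} (hw : ∀ i, cs.IsRightDescent w i) (v : W) :
    cs.length (w * v⁻¹) + cs.length v = cs.length w := by
  suffices h : ∃ x, cs.IsReduced x ∧ x.length + cs.length v = cs.length w ∧ cs.wordProd x * v = w by
    obtain ⟨x, hx, hlen, h⟩ := h
    rw [← hlen, ← hx.eq, ← h, mul_inv_cancel_right]
  obtain ⟨ω, hω, rfl⟩ := cs.exists_isReduced v
  rw [hω.eq]
  induction ω using List.reverseRecOn with
  | nil =>
    obtain ⟨x, hx, rfl⟩ := cs.exists_isReduced w
    exact ⟨x, hx, by simp [hx.eq], by simp⟩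
  | append_singleton ω i ih =>
    have hω' : cs.IsReduced ω := by simpa using hω.take ω.length
    obtain ⟨x, hx, hlen, he⟩ := ih hω'
    rw [← wordProd_append] at he
    have hi := hw i
    rw [← he] at hi
    obtain ⟨p, hp, -, hp'⟩ := hi.exists_eraseIdx
    -- The erased letter must lie in `x`: otherwise the reduced word `ω ++ [i]` would have the
    -- product of a word shorter than `ω`.
    by_cases hpx : p < x.length
    · have hw' : cs.wordProd (x.eraseIdx p) * cs.wordProd (ω ++ [i]) = w := by
        rw [eraseIdx_append_of_lt_length hpx, wordProd_append (ω := x.eraseIdx p)] at hp'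
        rw [wordProd_append, ← mul_assoc, ← hp', wordProd_singleton,
          simple_mul_simple_cancel_right, he]
      have hlen' : (x.eraseIdx p).length + (ω ++ [i]).length = cs.length w := by
        rw [← hlen, length_append, length_singleton, ← length_eraseIdx_add_one hpx]
        omega
      refine ⟨_, ?_, hlen', hw'⟩
      have h1 := cs.length_mul_le (cs.wordProd (x.eraseIdx p)) (cs.wordProd (ω ++ [i]))
      rw [hw', hω.eq] at h1
      exact le_antisymm (cs.length_wordProd_le _) (by omega)
    · exfalso
      rw [not_lt] at hpx
      rw [eraseIdx_append_of_length_le hpx, wordProd_append, wordProd_append, mul_assoc,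
        mul_right_inj] at hp'
      have h1 := hω.eq
      rw [wordProd_append, wordProd_singleton, hp', length_append] at h1
      have h2 := cs.length_wordProd_le (ω.eraseIdx (p - x.length))
      have h3 := length_eraseIdx_le (l := ω) (i := p - x.length)
      simp only [length_singleton] at h1
      omega

theorem eq_of_forall_isRightDescent {w : W} (hw : ∀ i, cs.IsRightDescent w i) {v : W}
    (hv : cs.length w ≤ cs.length v) : v = w := by
  have h := cs.length_mul_inv_add_length hw v
  have h0 : cs.length (w * v⁻¹) = 0 := by omega
  rw [cs.length_eq_zero_iff, mul_inv_eq_one] at h0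
  exact h0.symm

theorem exists_longest [Finite W] : ∃ w₀ : W, (∀ i, cs.IsRightDescent w₀ i) ∧
    (∀ w, w ≠ w₀ → cs.length w < cs.length w₀) ∧ w₀⁻¹ = w₀ ∧
    ∀ w, (∀ i, cs.IsLeftDescent w i) → w = w₀ := by
  obtain ⟨w₀, hmax⟩ := Finite.exists_max cs.length
  have hd : ∀ i, cs.IsRightDescent w₀ i := fun i =>
    lt_of_le_of_ne (hmax _) (cs.length_mul_simple_ne w₀ i)
  have hinv : w₀⁻¹ = w₀ := cs.eq_of_forall_isRightDescent hd (cs.length_inv w₀).ge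
  refine ⟨w₀, hd, fun w hw => ?_, hinv, fun w hw => ?_⟩
  · by_contra h
    exact hw (cs.eq_of_forall_isRightDescent hd (not_lt.1 h))
  · have hw' : ∀ i, cs.IsRightDescent w⁻¹ i := fun i => cs.isRightDescent_inv_iff.2 (hw i)
    have h := cs.eq_of_forall_isRightDescent hw' (v := w₀) (hmax _)
    rw [← hinv, h, inv_inv]

end CoxeterSystem

/-! ### Nil-Coxeter algebras of Coxeter groups -/

namespace GenCoxeterMatrix

variable (k : Type*) [CommRing k] {I : Type*} (M : GenCoxeterMatrix I)

/-- The Coxeter system of `W(M)`. -/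
noncomputable abbrev coxeterSystem : CoxeterSystem M.coxeterMatrix M.coxeterMatrix.Group :=
  M.coxeterMatrix.toCoxeterSystem

theorem coxeterMatrix_apply {i j : I} (hij : i ≠ j) : M.coxeterMatrix i j = (M.m i j).toNat := by
  simp [coxeterMatrix, hij]

theorem word_eq_of_isReduced {ω ω' : List I} (hω : M.coxeterSystem.IsReduced ω)
    (hω' : M.coxeterSystem.IsReduced ω')
    (h : M.coxeterSystem.wordProd ω = M.coxeterSystem.wordProd ω') :
    word k M ω = word k M ω' := by
  refine M.coxeterSystem.prod_map_eq_of_isReduced (fun i j hij h0 => ?_) hω hω' h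
  rw [M.coxeterMatrix_apply hij] at h0 ⊢
  refine word_alternatingWord k M i j _ hij (ENat.natCast_toNat ?_).symm
  rintro ht
  simp [ht] at h0

open Classical in
/-- The partial action of the generators on `W(M)` by length-increasing multiplication. -/
noncomputable def coxeterAct (i : I) (w : M.coxeterMatrix.Group) : Option M.coxeterMatrix.Group :=
  if M.coxeterSystem.IsLeftDescent w i then none else some (M.coxeterSystem.simple i * w)

open Classical in
-- A word acts exactly when every step lengthens. The criterion sees only the product and the number
-- of letters, so the braid relations for the partial action are immediate.
theorem actWord_coxeterAct (ω : List I) (w : M.coxeterMatrix.Group) :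
    actWord M.coxeterAct ω w =
      if M.coxeterSystem.length (M.coxeterSystem.wordProd ω * w) =
        ω.length + M.coxeterSystem.length w then some (M.coxeterSystem.wordProd ω * w) else none := by
  induction ω with
  | nil => simp [actWord_nil]
  | cons i ω ih =>
    have h1 : M.coxeterSystem.length (M.coxeterSystem.wordProd ω * w) ≤
        ω.length + M.coxeterSystem.length w :=
      (M.coxeterSystem.length_mul_le _ _).trans
        (Nat.add_le_add_right (M.coxeterSystem.length_wordProd_le ω) _)
    have h2 := M.coxeterSystem.length_simple_mul (M.coxeterSystem.wordProd ω * w) i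
    rw [actWord_cons, ih, CoxeterSystem.wordProd_cons, mul_assoc, List.length_cons]
    split_ifs with h3 h4 h4
    · have : ¬ M.coxeterSystem.IsLeftDescent (M.coxeterSystem.wordProd ω * w) i := by
        rw [CoxeterSystem.IsLeftDescent]; omega
      simp [coxeterAct, this]
    · have : M.coxeterSystem.IsLeftDescent (M.coxeterSystem.wordProd ω * w) i := by
        rw [CoxeterSystem.IsLeftDescent]; omega
      simp [coxeterAct, this]
    · omega
    · rfl

/-- A reduced word of an element of `W(M)`. -/
noncomputable def reducedWord (w : M.coxeterMatrix.Group) : List I :=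
  (M.coxeterSystem.exists_isReduced w).choose

theorem reducedWord_isReduced (w : M.coxeterMatrix.Group) :
    M.coxeterSystem.IsReduced (M.reducedWord w) :=
  (M.coxeterSystem.exists_isReduced w).choose_spec.1

theorem wordProd_reducedWord (w : M.coxeterMatrix.Group) :
    M.coxeterSystem.wordProd (M.reducedWord w) = w :=
  (M.coxeterSystem.exists_isReduced w).choose_spec.2.symm

theorem T_mul_reducedWord_of_not_isLeftDescent {i : I} {w : M.coxeterMatrix.Group}
    (h : ¬ M.coxeterSystem.IsLeftDescent w i) :
    T k M i * word k M (M.reducedWord w) =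
      word k M (M.reducedWord (M.coxeterSystem.simple i * w)) := by
  rw [← word_cons]
  apply word_eq_of_isReduced
  · rw [CoxeterSystem.IsReduced, CoxeterSystem.wordProd_cons, wordProd_reducedWord,
      List.length_cons, ← (M.reducedWord_isReduced w).eq, wordProd_reducedWord]
    exact M.coxeterSystem.not_isLeftDescent_iff.1 h
  · exact M.reducedWord_isReduced _
  · rw [CoxeterSystem.wordProd_cons, wordProd_reducedWord, wordProd_reducedWord]

variable {M} in
/-- The basis of a nil-Coxeter algebra indexed by the Coxeter group. -/
noncomputable def coxeterNormalForm (hM : ∀ i, M.m i i = 2) :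
    NormalForm k M M.coxeterMatrix.Group where
  act := M.coxeterAct
  V := Set.univ
  base := 1
  nf w := word k M (M.reducedWord w)
  braid i j a hij ha w := by
    have h : M.coxeterMatrix i j = a := by rw [M.coxeterMatrix_apply hij, ha]; rfl
    have hw := M.coxeterSystem.wordProd_braidWord_eq i j
    rw [CoxeterSystem.braidWord, CoxeterSystem.braidWord, M.coxeterMatrix.symmetric j i, h] at hw
    rw [actWord_coxeterAct, actWord_coxeterAct, hw, CoxeterSystem.length_alternatingWord,
      CoxeterSystem.length_alternatingWord]
  order i w := by
    have : (M.m i i).toNat = 2 := by rw [hM i]; rfl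
    have h1 : M.coxeterSystem.wordProd (List.replicate 2 i) = 1 := by
      simp only [List.replicate, CoxeterSystem.wordProd_cons, CoxeterSystem.wordProd_nil, mul_one,
        CoxeterSystem.simple_mul_simple_self]
    rw [this, actWord_coxeterAct, h1, if_neg]
    simp
  base_mem := trivial
  nf_base := by
    have h : M.reducedWord 1 = [] := by
      rw [← List.length_eq_zero_iff, ← (M.reducedWord_isReduced 1).eq, wordProd_reducedWord,
        CoxeterSystem.length_one]
    rw [h, word_nil]
  act_mem _ _ _ _ _ := trivial
  act_inj i w _ w' _ z h h' := by
    unfold coxeterAct at h h'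
    split_ifs at h h' with h1 h2
    have := (Option.some.inj h).trans (Option.some.inj h').symm
    exact mul_left_cancel this
  T_mul_nf i w _ := by
    unfold coxeterAct
    split_ifs with h
    · have h' := M.coxeterSystem.isLeftDescent_iff_not_isLeftDescent_mul.1 h
      have h2 := T_mul_reducedWord_of_not_isLeftDescent k M h'
      rw [CoxeterSystem.simple_mul_simple_cancel_left] at h2
      have h3 := T_pow_eq_zero k M i
      rw [hM i] at h3
      rw [← h2, ← mul_assoc, ← pow_two]
      exact (congrArg (· * _) h3).trans (zero_mul _)
    · exact T_mul_reducedWord_of_not_isLeftDescent k M h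
  reach w _ := by
    refine ⟨M.reducedWord w, ?_⟩
    rw [actWord_coxeterAct, wordProd_reducedWord, mul_one, if_pos]
    rw [CoxeterSystem.length_one, ← (M.reducedWord_isReduced w).eq, wordProd_reducedWord, add_zero]

variable {M} in
/-- The primitive elements of the nil-Coxeter algebra of a finite Coxeter group. -/
theorem prim_of_finite_coxeterGroup (hM : ∀ i, M.m i i = 2) [Finite M.coxeterMatrix.Group] :
    ∃ w₀ : M.coxeterMatrix.Group,
      (∀ w, w ≠ w₀ →
        M.coxeterMatrix.toCoxeterSystem.length w < M.coxeterMatrix.toCoxeterSystem.length w₀) ∧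
      (∀ ω : List I, M.coxeterMatrix.toCoxeterSystem.IsReduced ω →
        M.coxeterMatrix.toCoxeterSystem.wordProd ω = w₀ →
        primL k M = Submodule.span k {word k M ω} ∧
        primR k M = Submodule.span k {word k M ω} ∧
        prim k M = Submodule.span k {word k M ω}) ∧
      ∀ θ : NC k M →ₗ[k] NC k M, IsAntiInvolution k M θ → ∀ x ∈ prim k M, θ x = x := by
  obtain ⟨w₀, hd, hmax, hinv, huniq⟩ := M.coxeterSystem.exists_longest
  have hd' : ∀ i, M.coxeterSystem.IsLeftDescent w₀ i := fun i => by
    rw [← M.coxeterSystem.isRightDescent_inv_iff, hinv]; exact hd i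
  have hL : ∀ ω : List I, M.coxeterSystem.IsReduced ω → M.coxeterSystem.wordProd ω = w₀ →
      primL k M = Submodule.span k {word k M ω} := by
    intro ω hω hw
    have hset : {w ∈ (coxeterNormalForm k hM).V | ∀ i, (coxeterNormalForm k hM).act i w = none} =
        {w₀} := by
      ext w
      have : (∀ i, (coxeterNormalForm k hM).act i w = none) ↔
          ∀ i, M.coxeterSystem.IsLeftDescent w i := by
        refine forall_congr' fun i => ?_
        change M.coxeterAct i w = none ↔ _
        unfold coxeterAct
        split_ifs with h <;> simp [h]
      rw [Set.mem_ofPred_eq, this, Set.mem_singleton_iff]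
      refine ⟨fun h => huniq w h.2, ?_⟩
      rintro rfl
      exact ⟨trivial, hd'⟩
    rw [(coxeterNormalForm k hM).primL_eq, hset, Set.image_singleton]
    congr 2
    exact word_eq_of_isReduced k M (M.reducedWord_isReduced w₀) hω
      ((M.wordProd_reducedWord w₀).trans hw.symm)
  have hθ : ∀ θ : NC k M →ₗ[k] NC k M, IsAntiInvolution k M θ → ∀ ω : List I,
      M.coxeterSystem.IsReduced ω → M.coxeterSystem.wordProd ω = w₀ →
      ∀ x ∈ ({word k M ω} : Set (NC k M)), θ x = x := by
    rintro θ hθ ω hω hw x rfl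
    rw [hθ.map_word]
    refine word_eq_of_isReduced k M hω.reverse hω ?_
    rw [CoxeterSystem.wordProd_reverse, hw, hinv]
  refine ⟨w₀, hmax, fun ω hω hw => ?_, fun θ h x hx => ?_⟩
  · obtain ⟨θ, h⟩ := exists_isAntiInvolution k M
    have h1 := hL ω hω hw
    have h2 := h.primR_eq_span h1 (hθ θ h ω hω hw)
    exact ⟨h1, h2, by rw [prim, h1, h2, inf_idem]⟩
  · have h1 := hL _ (M.reducedWord_isReduced w₀) (M.wordProd_reducedWord w₀)
    refine apply_eq_self_of_mem_span
      (hθ θ h _ (M.reducedWord_isReduced w₀) (M.wordProd_reducedWord w₀)) (h1 ▸ hx.1)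

end GenCoxeterMatrix

/-! ### Normal forms for braid relations of type `A` -/

section Blocks

variable {G : Type*} [Monoid G]

/-- The product `t (q - 1) * t (q - 2) * ⋯` with `l` factors (at most `q`). -/
def block (t : ℕ → G) : ℕ → ℕ → G
  | 0, _ => 1
  | _ + 1, 0 => 1
  | q + 1, l + 1 => t q * block t q l

/-- The product of the blocks of lengths `L 1, …, L q` starting with `t 0, …, t (q - 1)`. -/
def stair (t : ℕ → G) (L : ℕ → ℕ) : ℕ → G
  | 0 => 1
  | q + 1 => stair t L q * block t (q + 1) (L (q + 1))

/-- The sequence `L` with `(a, b)` at the positions `(i, i + 1)` replaced by `(b, a + 1)`. -/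
def raise (i : ℕ) (L : ℕ → ℕ) (j : ℕ) : ℕ :=
  if j = i then L (i + 1) else if j = i + 1 then L i + 1 else L j

theorem raise_self (i : ℕ) (L : ℕ → ℕ) : raise i L i = L (i + 1) := by simp [raise]

theorem raise_succ (i : ℕ) (L : ℕ → ℕ) : raise i L (i + 1) = L i + 1 := by simp [raise]

theorem raise_of_ne {i j : ℕ} (L : ℕ → ℕ) (h : j ≠ i) (h' : j ≠ i + 1) : raise i L j = L j := by
  simp [raise, h, h']

/-- The inverse operation of `raise i`. -/
def lower (i : ℕ) (L : ℕ → ℕ) (j : ℕ) : ℕ :=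
  if j = i then L (i + 1) - 1 else if j = i + 1 then L i else L j

theorem lower_self (i : ℕ) (L : ℕ → ℕ) : lower i L i = L (i + 1) - 1 := by simp [lower]

theorem lower_succ (i : ℕ) (L : ℕ → ℕ) : lower i L (i + 1) = L i := by simp [lower]

theorem lower_of_ne {i j : ℕ} (L : ℕ → ℕ) (h : j ≠ i) (h' : j ≠ i + 1) : lower i L j = L j := by
  simp [lower, h, h']

theorem raise_lower {i : ℕ} {L : ℕ → ℕ} (h : L i < L (i + 1)) : raise i (lower i L) = L := by
  funext j
  simp only [raise, lower]
  split_ifs <;> first | omega | simp_all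
  omega

/-- The braid relations of type `A` for the elements `t i` with `i < N`. -/
structure IsBraidSeq (t : ℕ → G) (N : ℕ) : Prop where
  braid : ∀ i, i + 1 < N → t i * t (i + 1) * t i = t (i + 1) * t i * t (i + 1)
  comm : ∀ i j, i + 2 ≤ j → j < N → t i * t j = t j * t i

theorem block_zero_right (t : ℕ → G) (q : ℕ) : block t q 0 = 1 := by
  cases q <;> rfl

theorem block_succ (t : ℕ → G) (q l : ℕ) : block t (q + 1) (l + 1) = t q * block t q l := rfl

theorem block_add (t : ℕ → G) (q a b : ℕ) :
    block t (q + a) (a + b) = block t (q + a) a * block t q b := by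
  induction a with
  | zero => simp [block_zero_right]
  | succ a ih =>
    rw [← Nat.add_assoc, Nat.add_right_comm a 1 b, block_succ, block_succ, ih, mul_assoc]

theorem block_succ_right (t : ℕ → G) (q a : ℕ) :
    block t (q + 1 + a) (a + 1) = block t (q + 1 + a) a * t q := by
  rw [block_add, block_succ, block_zero_right, mul_one]

theorem stair_succ (t : ℕ → G) (L : ℕ → ℕ) (q : ℕ) :
    stair t L (q + 1) = stair t L q * block t (q + 1) (L (q + 1)) := rfl

theorem stair_congr (t : ℕ → G) {L L' : ℕ → ℕ} {q : ℕ} (h : ∀ j, 1 ≤ j → j ≤ q → L j = L' j) :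
    stair t L q = stair t L' q := by
  induction q with
  | zero => rfl
  | succ q ih =>
    rw [stair_succ, stair_succ, ih fun j h1 h2 => h j h1 (by omega), h (q + 1) (by omega) le_rfl]

namespace IsBraidSeq

variable {t : ℕ → G} {N : ℕ} (ht : IsBraidSeq t N)
include ht

theorem commute_block_of_lt {q j : ℕ} (l : ℕ) (hj : q < j) (hN : j < N) :
    Commute (t j) (block t q l) := by
  induction q generalizing l with
  | zero => exact Commute.one_right _
  | succ q ih =>
    cases l with
    | zero => exact Commute.one_right _
    | succ l => exact Commute.mul_right (ht.comm q j (by omega) hN).symm (ih l (by omega))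

theorem commute_block_of_add_lt {q l j : ℕ} (hj : j + l + 1 < q) (hN : q ≤ N) :
    Commute (t j) (block t q l) := by
  induction q generalizing l with
  | zero => exact Commute.one_right _
  | succ q ih =>
    cases l with
    | zero => exact Commute.one_right _
    | succ l => exact Commute.mul_right (ht.comm j q (by omega) (by omega)) (ih (by omega) (by omega))

theorem commute_stair {q j : ℕ} (L : ℕ → ℕ) (hj : q < j) (hN : j < N) :
    Commute (t j) (stair t L q) := by
  induction q with
  | zero => exact Commute.one_right _
  | succ q ih => exact Commute.mul_right (ih (by omega)) (ht.commute_block_of_lt _ hj hN)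

theorem commute_stair_of_eq_zero {q : ℕ} {L : ℕ → ℕ} (h : L q = 0) (hN : q < N) :
    Commute (t q) (stair t L q) := by
  cases q with
  | zero => exact Commute.one_right _
  | succ q =>
    rw [stair_succ, h, block_zero_right, mul_one]
    exact ht.commute_stair L (Nat.lt_succ_self q) hN

/-- The block contains `t (j + 1) * t j`. The incoming `t (j + 1)` commutes with the letters below
`j`, the braid relation turns it into `t j` in front of this pair, and `t j` commutes with the
letters above. -/
theorem block_mul_succ {q l j : ℕ} (hl : l ≤ q) (hN : q ≤ N) (h1 : q < j + l + 1)
    (h2 : j + 2 ≤ q) : block t q l * t (j + 1) = t j * block t q l := by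
  induction q generalizing l with
  | zero => omega
  | succ q ih =>
    obtain ⟨l, rfl⟩ : ∃ m, l = m + 1 := ⟨l - 1, by omega⟩
    rw [block_succ]
    by_cases hjq : j + 1 = q
    · subst hjq
      obtain ⟨l, rfl⟩ : ∃ m, l = m + 1 := ⟨l - 1, by omega⟩
      rw [block_succ, mul_assoc, mul_assoc,
        ← (ht.commute_block_of_lt l (Nat.lt_succ_self j) (by omega)).eq, ← mul_assoc, ← mul_assoc,
        ← ht.braid j (by omega)]
      simp only [mul_assoc]
    · rw [mul_assoc, ih (by omega) (by omega) (by omega) (by omega), ← mul_assoc,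
        ← ht.comm j q (by omega) (by omega), mul_assoc]

theorem block_mul_block {Q l p b : ℕ} (hl : l ≤ Q) (hN : Q ≤ N) (hp : p + 1 ≤ Q) (hb : b ≤ p)
    (h : Q + b ≤ l + p) : block t Q l * block t (p + 1) b = block t p b * block t Q l := by
  induction b generalizing p with
  | zero => simp [block_zero_right]
  | succ b ih =>
    obtain ⟨p, rfl⟩ : ∃ m, p = m + 1 := ⟨p - 1, by omega⟩
    rw [block_succ, block_succ, ← mul_assoc,
      ht.block_mul_succ hl hN (by omega) (by omega), mul_assoc,
      ih (by omega) (by omega) (by omega), mul_assoc]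

/-- The local form of `raise`: the new letter lengthens the first block to `a + 1`, and the second
passes through it with all indices lowered by one. -/
theorem mul_block_mul_block {q a b : ℕ} (ha : a ≤ q) (hN : q < N) (hba : b ≤ a) :
    t q * block t q a * block t (q + 1) b = block t q b * block t (q + 1) (a + 1) := by
  rw [← block_succ]
  exact ht.block_mul_block (by omega) hN le_rfl (by omega) (by omega)

/-- The letter `t i` commutes with the blocks before the `i`-th and then meets the blocks `i` and `i
+ 1`. For `i = 0` the first of these is empty. -/
theorem mul_stair {L : ℕ → ℕ} {i q : ℕ} (hi : i < q) (hq : q ≤ N) (hL : L i ≤ i)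
    (h : L (i + 1) ≤ L i) : t i * stair t L q = stair t (raise i L) q := by
  induction q with
  | zero => omega
  | succ q ih =>
    by_cases hiq : i = q
    · subst hiq
      rw [stair_succ, stair_succ, raise_succ]
      cases i with
      | zero =>
        have : L (0 + 1) = 0 := by omega
        rw [this, block_zero_right, mul_one, Nat.le_zero.1 hL]
        simp [stair, block]
      | succ i =>
        rw [stair_succ, stair_succ, raise_self, mul_assoc, mul_assoc,
          ← ht.mul_block_mul_block hL (by omega) h, ← mul_assoc,
          (ht.commute_stair L (Nat.lt_succ_self i) (by omega)).eq,
          stair_congr t (L := raise (i + 1) L) (L' := L)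
            fun j _ h2 => raise_of_ne L (by omega) (by omega)]
        simp only [mul_assoc]
    · rw [stair_succ, stair_succ, ← mul_assoc, ih (by omega) (by omega),
        raise_of_ne L (by omega) (by omega)]

/-- The stair with all blocks of maximal length is a palindrome. -/
theorem stair_id_succ {q : ℕ} (hq : q + 1 ≤ N) :
    stair t id (q + 1) = ((List.range (q + 1)).map t).prod * stair t id q := by
  induction q with
  | zero => simp [stair, block]
  | succ q ih =>
    have hc := (ht.commute_stair id (Nat.lt_succ_self q) (by omega)).eq
    have hp : ((List.range (q + 1 + 1)).map t).prod =
        ((List.range (q + 1)).map t).prod * t (q + 1) := by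
      rw [List.range_succ, List.map_append, List.prod_append, List.map_singleton,
        List.prod_singleton]
    calc stair t id (q + 1 + 1)
        = ((List.range (q + 1)).map t).prod * (stair t id q * t (q + 1)) *
            block t (q + 1) (q + 1) := by
          rw [stair_succ, ih (by omega), id, block_succ]
          simp only [mul_assoc]
      _ = ((List.range (q + 1 + 1)).map t).prod * stair t id (q + 1) := by
          rw [← hc, hp, stair_succ t id q, id]
          simp only [mul_assoc]

end IsBraidSeq

end Blocks

/-! ### Vanishing products of blocks when generators have square zero. -/

section NilBlocks

variable {A : Type*} [Ring A] {t : ℕ → A} {N : ℕ} (ht : IsBraidSeq t N)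
include ht

/-- At an ascent of `L` the stair is itself `t i` times the stair of `lower i L`, so a square
appears. -/
theorem IsBraidSeq.mul_stair_eq_zero {L : ℕ → ℕ} {i q : ℕ} (hi : i < q) (hq : q ≤ N)
    (hL : L (i + 1) ≤ i + 1) (hsq : t i * t i = 0) (h : L i < L (i + 1)) :
    t i * stair t L q = 0 := by
  rw [← raise_lower h, ← ht.mul_stair hi hq (by rw [lower_self]; omega)
    (by rw [lower_self, lower_succ]; omega), ← mul_assoc, hsq, zero_mul]

/-- The first `l` letters of the second block pass through the first with lowered indices. The last
letter of the first block then meets the same letter in the second. -/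
theorem IsBraidSeq.block_mul_block_eq_zero {Q l b : ℕ} (hl : l < Q) (hN : Q ≤ N)
    (hlb : l < b) (hsq : t (Q - l - 1) * t (Q - l - 1) = 0) :
    block t Q (l + 1) * block t Q b = 0 := by
  obtain ⟨q, rfl⟩ : ∃ q, Q = q + 1 + l := ⟨Q - l - 1, by omega⟩
  obtain ⟨c, rfl⟩ : ∃ c, b = l + (c + 1) := ⟨b - l - 1, by omega⟩
  have e : q + 1 + l - l - 1 = q := by omega
  rw [e] at hsq
  have h1 : block t (q + 1 + l) (l + 1) * block t (q + 1 + l) l =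
      block t (q + l) l * block t (q + 1 + l) (l + 1) := by
    rw [Nat.add_right_comm q 1 l]
    exact ht.block_mul_block (by omega) (by omega) le_rfl (by omega) (by omega)
  rw [block_add t (q + 1) l (c + 1), ← mul_assoc, h1, block_succ, block_succ_right, mul_assoc, mul_assoc,
    ← mul_assoc (t q), hsq, zero_mul, mul_zero, mul_zero]

end NilBlocks

/-! ### The normal form of `NC_A(n, d)` -/

theorem raise_raise_of_add_two_le {i j : ℕ} (h : i + 2 ≤ j) (L : ℕ → ℕ) :
    raise i (raise j L) = raise j (raise i L) := by
  funext m
  simp only [raise]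
  split_ifs <;> omega

/-- Both sides send the entries `(a, b, c)` at `i, i + 1, i + 2` to `(c, b + 1, a + 2)`. -/
theorem raise_braid (i : ℕ) (L : ℕ → ℕ) :
    raise i (raise (i + 1) (raise i L)) = raise (i + 1) (raise i (raise (i + 1) L)) := by
  funext m
  simp only [raise]
  split_ifs <;> omega

theorem sum_raise (i n : ℕ) (hi : i + 2 ≤ n) (L : ℕ → ℕ) :
    ∑ j ∈ Finset.range n, raise i L j = ∑ j ∈ Finset.range n, L j + 1 := by
  induction n, hi using Nat.le_induction with
  | base =>
    have h : ∑ j ∈ Finset.range i, raise i L j = ∑ j ∈ Finset.range i, L j :=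
      Finset.sum_congr rfl fun j hj => by
        rw [Finset.mem_range] at hj
        exact raise_of_ne L (by omega) (by omega)
    rw [Finset.sum_range_succ, Finset.sum_range_succ, Finset.sum_range_succ, Finset.sum_range_succ,
      raise_self, raise_succ, h]
    ring
  | succ n hn ih =>
    rw [Finset.sum_range_succ, ih, Finset.sum_range_succ, raise_of_ne L (by omega) (by omega)]
    omega

namespace GenCoxeterMatrix

section TypeA

variable (r d : ℕ)

/-- The partial action of the generators of `NC_A(r + 1, d)` on pairs of a sequence of block
lengths and an exponent of the last generator. -/
def typeAAct (i : Fin (r + 1)) (x : (ℕ → ℕ) × ℕ) : Option ((ℕ → ℕ) × ℕ) :=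
  if i.val < r then
    if x.1 (i + 1) ≤ x.1 i then some (raise i x.1, x.2) else none
  -- While the exponent is at most `1`, the last generator behaves as in a Coxeter group. In the
  -- branch after this one the `r`-th block is empty, so the generator commutes with the stair and
  -- raises the exponent.
  else if x.2 ≤ 1 ∧ x.1 (r + 1) ≤ x.1 r then some (raise r x.1, 1)
  else if x.1 r = 0 ∧ 1 ≤ x.2 ∧ x.2 + 1 < d then some (x.1, x.2 + 1)
  else none

/-- The pairs indexing the basis of `NC_A(r + 1, d)`. -/
def typeAIndex : Set ((ℕ → ℕ) × ℕ) :=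
  {x | (∀ j ≤ r + 1, x.1 j ≤ j) ∧ (∀ j, r + 1 < j → x.1 j = 0) ∧
    (x.2 = 0 ↔ x.1 (r + 1) = 0) ∧ x.2 < d}

variable {r d}

theorem typeAAct_of_lt {i : Fin (r + 1)} (h : i.val < r) (L : ℕ → ℕ) (a : ℕ) :
    typeAAct r d i (L, a) = if L (i + 1) ≤ L i then some (raise i L, a) else none := by
  simp [typeAAct, h]

theorem typeAAct_of_eq {i : Fin (r + 1)} (h : i.val = r) (L : ℕ → ℕ) (a : ℕ) :
    typeAAct r d i (L, a) = if a ≤ 1 ∧ L (r + 1) ≤ L r then some (raise r L, 1)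
      else if L r = 0 ∧ 1 ≤ a ∧ a + 1 < d then some (L, a + 1) else none := by
  simp [typeAAct, h]

theorem typeAAct_comm {i j : Fin (r + 1)} (hij : i.val + 2 ≤ j.val) (x : (ℕ → ℕ) × ℕ) :
    (typeAAct r d i x).bind (typeAAct r d j) = (typeAAct r d j x).bind (typeAAct r d i) := by
  obtain ⟨L, a⟩ := x
  have hi : i.val < r := by omega
  have e1 : raise i L j = L j := raise_of_ne L (by omega) (by omega)
  have e2 : raise i L (j + 1) = L (j + 1) := raise_of_ne L (by omega) (by omega)
  have e3 : raise j L i = L i := raise_of_ne L (by omega) (by omega)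
  have e4 : raise j L (i + 1) = L (i + 1) := raise_of_ne L (by omega) (by omega)
  have e5 := raise_raise_of_add_two_le hij L
  obtain hj | hj : j.val < r ∨ j.val = r := by omega
  · rw [typeAAct_of_lt hi, typeAAct_of_lt hj]
    split_ifs with h1 h2 h2 <;> simp [typeAAct_of_lt hi, typeAAct_of_lt hj, *]
  · rw [hj] at e1 e2 e3 e4 e5
    rw [typeAAct_of_lt hi, typeAAct_of_eq hj]
    split_ifs with h1 h2 h3 h2 h3 <;>
      simp only [Option.bind_some, Option.bind_none, typeAAct_of_lt hi, typeAAct_of_eq hj,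
        e1, e2, e3, e4, e5, if_pos, h1, if_false] <;>
      split_ifs <;> rfl

/-- For exponents at most `1` the core is `raise_braid`. If `j` is last and the exponent is at least
`2`, both sides are undefined: acting by `i` makes the `r`-th block nonempty, after which `j` cannot
act. -/
theorem typeAAct_braid {i j : Fin (r + 1)} (hij : i.val + 1 = j.val) (x : (ℕ → ℕ) × ℕ) :
    ((typeAAct r d i x).bind (typeAAct r d j)).bind (typeAAct r d i) =
      ((typeAAct r d j x).bind (typeAAct r d i)).bind (typeAAct r d j) := by
  obtain ⟨L, a⟩ := x
  have hi : i.val < r := by omega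
  have e1 : raise i L (i + 1 + 1) = L (i + 1 + 1) := raise_of_ne L (by omega) (by omega)
  have e2 : raise (i + 1) L i = L i := raise_of_ne L (by omega) (by omega)
  have e3 : raise (i + 1) (raise i L) i = L (i + 1) := by
    rw [raise_of_ne _ (by omega) (by omega), raise_self]
  have e4 : raise i (raise (i + 1) L) (i + 1 + 1) = L (i + 1) + 1 := by
    rw [raise_of_ne _ (by omega) (by omega), raise_succ]
  have e5 := raise_braid i L
  obtain hj | hj : j.val < r ∨ j.val = r := by omega
  · rw [typeAAct_of_lt hi, typeAAct_of_lt hj, ← hij]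
    by_cases h1 : L (i + 1) ≤ L i <;> by_cases h2 : L (i + 1 + 1) ≤ L (i + 1) <;>
      by_cases h3 : L (i + 1 + 1) ≤ L i <;> by_cases h4 : L (i + 1 + 1) ≤ L i + 1 <;>
      first
      | omega
      | simp [h1, h2, h3, h4, typeAAct_of_lt hi, typeAAct_of_lt hj, ← hij, e1, e2, e3, e4, e5,
          raise_self, raise_succ]
  · have hr : i.val + 1 = r := by omega
    rw [hr] at e1 e2 e3 e4 e5
    have e6 : raise i L i = L r := by rw [raise_self, hr]
    have e7 : raise i L r = L i + 1 := by
      have := raise_succ i L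
      rwa [hr] at this
    have e8 : raise r L r = L (r + 1) := raise_self r L
    have e9 : raise i (raise r L) r = L i + 1 := by
      have := raise_succ i (raise r L)
      rwa [hr, e2] at this
    rw [typeAAct_of_lt hi, typeAAct_of_eq hj, hr]
    split_ifs with h1 h2 h3 h2 h3 <;>
      simp only [Option.bind_some, Option.bind_none, typeAAct_of_lt hi, typeAAct_of_eq hj, hr,
        e1, e2, e7, e8] <;>
      split_ifs <;>
      simp only [Option.bind_some, Option.bind_none, hr, e3, e4, e5, e9, raise_self] <;>
      split_ifs <;> first | rfl | omega | tauto

/-- The final disjunction is the invariant: after one step the raising branch is closed, so every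
further step increases the exponent, which stays below `d`. Hence `d` steps are impossible. -/
theorem typeAAct_replicate_last (hd : 2 ≤ d) (n : ℕ) (x y : (ℕ → ℕ) × ℕ)
    (h : actWord (typeAAct r d) (List.replicate (n + 1) (Fin.last r)) x = some y) :
    n + 1 ≤ y.2 ∧ y.2 < d ∧ (y.1 r < y.1 (r + 1) ∨ 2 ≤ y.2) := by
  induction n generalizing y with
  | zero =>
    obtain ⟨L, a⟩ := x
    change typeAAct r d (Fin.last r) (L, a) = some y at h
    rw [typeAAct_of_eq (Fin.val_last r)] at h
    split_ifs at h with h1 h2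
    · obtain rfl := Option.some.inj h
      simp only [raise_self, raise_succ]
      exact ⟨le_rfl, hd, Or.inl (by omega)⟩
    · obtain rfl := Option.some.inj h
      exact ⟨by simp, h2.2.2, Or.inr (by simp; omega)⟩
  | succ n ih =>
    rw [List.replicate_succ, actWord_cons] at h
    obtain ⟨⟨L, a⟩, hz, hy⟩ := Option.bind_eq_some_iff.1 h
    have := ih _ hz
    simp only at this
    rw [typeAAct_of_eq (Fin.val_last r)] at hy
    split_ifs at hy with h1 h2
    · omega
    · obtain rfl := Option.some.inj hy
      exact ⟨by simp; omega, h2.2.2, Or.inr (by simp; omega)⟩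

theorem typeAAct_mem (hd : 2 ≤ d) (i : Fin (r + 1)) {x y : (ℕ → ℕ) × ℕ} (hx : x ∈ typeAIndex r d)
    (h : typeAAct r d i x = some y) : y ∈ typeAIndex r d := by
  obtain ⟨L, a⟩ := x
  obtain ⟨h1, h2, h3, h4⟩ := hx
  simp only at h1 h2 h3 h4
  have key : ∀ i ≤ r, L (i + 1) ≤ L i → (∀ j ≤ r + 1, raise i L j ≤ j) ∧
      ∀ j, r + 1 < j → raise i L j = 0 := by
    intro i hi hL
    have := h1 i (by omega)
    refine ⟨fun j hj => ?_, fun j hj => ?_⟩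
    · have := h1 j hj
      simp only [raise]
      split_ifs with e1 e2 <;> omega
    · rw [raise_of_ne L (by omega) (by omega), h2 j hj]
  obtain hi | hi : i.val < r ∨ i.val = r := by omega
  · rw [typeAAct_of_lt hi] at h
    split_ifs at h with hL
    obtain rfl := Option.some.inj h
    refine ⟨(key i hi.le hL).1, (key i hi.le hL).2, ?_, h4⟩
    simp only
    rw [raise_of_ne L (by omega) (by omega), h3]
  · rw [typeAAct_of_eq hi] at h
    split_ifs at h with hL hL'
    · obtain rfl := Option.some.inj h
      refine ⟨(key r le_rfl hL.2).1, (key r le_rfl hL.2).2, ?_, hd⟩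
      simp [raise_succ]
    · obtain rfl := Option.some.inj h
      refine ⟨h1, h2, ?_, hL'.2.2⟩
      simp only
      omega

theorem raise_injective (i : ℕ) : Function.Injective (raise i) := by
  intro L L' h
  funext j
  by_cases h1 : j = i
  · subst h1
    have := congrFun h (j + 1)
    rw [raise_succ, raise_succ] at this
    omega
  by_cases h2 : j = i + 1
  · subst h2
    have := congrFun h i
    rwa [raise_self, raise_self] at this
  · have := congrFun h j
    rwa [raise_of_ne L h1 h2, raise_of_ne L' h1 h2] at this

/-- For the last generator, the raising branch ends with exponent `1` and the other with at least
`2`. The raising branch forgets whether `a` was `0` or `1`, but in `typeAIndex` this can be read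
from the last block. -/
theorem typeAAct_inj (i : Fin (r + 1)) {x y z : (ℕ → ℕ) × ℕ} (hx : x ∈ typeAIndex r d)
    (hy : y ∈ typeAIndex r d) (hxz : typeAAct r d i x = some z) (hyz : typeAAct r d i y = some z) :
    x = y := by
  obtain ⟨L, a⟩ := x
  obtain ⟨L', a'⟩ := y
  have h3 := hx.2.2.1
  have h3' := hy.2.2.1
  simp only at h3 h3'
  obtain hi | hi : i.val < r ∨ i.val = r := by omega
  · rw [typeAAct_of_lt hi] at hxz hyz
    split_ifs at hxz hyz
    have := (Option.some.inj hxz).trans (Option.some.inj hyz).symm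
    rw [Prod.mk.injEq] at this ⊢
    exact ⟨raise_injective i this.1, this.2⟩
  · rw [typeAAct_of_eq hi] at hxz hyz
    split_ifs at hxz hyz with c1 c2 c3 c4 <;>
      have := (Option.some.inj hxz).trans (Option.some.inj hyz).symm <;>
      rw [Prod.mk.injEq] at this ⊢
    · have hL := raise_injective r this.1
      refine ⟨hL, ?_⟩
      rw [hL] at h3
      omega
    · omega
    · omega
    · exact ⟨this.1, by omega⟩

/-- A first letter can be removed from any nontrivial normal word: by lowering at an ascent of `L`,
or by reducing the exponent when it is at least `2`. The displayed sum is the measure for the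
descent. -/
theorem exists_typeAAct_eq {x : (ℕ → ℕ) × ℕ} (hx : x ∈ typeAIndex r d)
    (h0 : x ≠ (0, 0)) : ∃ i, ∃ y ∈ typeAIndex r d, typeAAct r d i y = some x ∧
      ∑ j ∈ Finset.range (r + 2), y.1 j + y.2 < ∑ j ∈ Finset.range (r + 2), x.1 j + x.2 := by
  obtain ⟨L, a⟩ := x
  obtain ⟨h1, h2, h3, h4⟩ := hx
  simp only at h1 h2 h3 h4
  have hlower : ∀ i, L i < L (i + 1) → ∃ L', raise i L' = L ∧ L' i = L (i + 1) - 1 ∧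
      L' (i + 1) = L i ∧ ∀ j, j ≠ i → j ≠ i + 1 → L' j = L j := fun i hi =>
    ⟨lower i L, raise_lower hi, lower_self i L, lower_succ i L, fun j => lower_of_ne L⟩
  by_cases hex : ∃ i < r, L i < L (i + 1)
  · obtain ⟨i, hi, hL⟩ := hex
    obtain ⟨L', rfl, e1, e2, e3⟩ := hlower i hL
    rw [raise_self, raise_succ] at hL
    refine ⟨⟨i, by omega⟩, (L', a), ⟨fun j hj => ?_, fun j hj => ?_, ?_, h4⟩, ?_, ?_⟩
    · have b1 := h1 i (by omega)
      have b2 := h1 (i + 1) (by omega)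
      have b3 := h1 j (by omega)
      rw [raise_self] at b1
      rw [raise_succ] at b2
      by_cases c1 : j = i
      · subst c1; simp only; omega
      by_cases c2 : j = i + 1
      · subst c2; simp only; omega
      simpa [raise_of_ne L' c1 c2] using b3
    · have b3 := h2 j hj
      rwa [raise_of_ne L' (by omega) (by omega)] at b3
    · rwa [raise_of_ne L' (by omega) (by omega)] at h3
    · rw [typeAAct_of_lt (by simpa using hi), if_pos (by simp only; omega)]
    · simp only
      rw [sum_raise i (r + 2) (by omega)]
      omega
  -- Since `L 0 = 0`, the absence of ascents before `r` empties all blocks but the last.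
  · have hz : ∀ j ≤ r, L j = 0 := by
      intro j hj
      induction j with
      | zero => simpa using h1 0 (by omega)
      | succ j ih =>
        by_contra hne
        exact hex ⟨j, by omega, by have := ih (by omega); omega⟩
    have ha : a ≠ 0 := by
      rintro rfl
      apply h0
      rw [Prod.mk.injEq]
      refine ⟨?_, rfl⟩
      funext j
      obtain hj | rfl | hj : j ≤ r ∨ j = r + 1 ∨ r + 1 < j := by omega
      · exact hz j hj
      · exact h3.1 rfl
      · exact h2 j hj
    have hpos : L (r + 1) ≠ 0 := fun h => ha (h3.2 h)
    have hLr := hz r le_rfl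
    obtain ha1 | ha2 : a = 1 ∨ 2 ≤ a := by omega
    · obtain ⟨L', rfl, e1, e2, e3⟩ := hlower r (by omega)
      rw [raise_self] at hLr
      rw [raise_succ] at hpos
      refine ⟨Fin.last r, (L', 0), ⟨fun j hj => ?_, fun j hj => ?_, ?_, by simp only; omega⟩, ?_, ?_⟩
      · have b2 := h1 (r + 1) (by omega)
        have b3 := h1 j (by omega)
        rw [raise_succ] at b2
        by_cases c1 : j = r
        · subst c1; simp only; omega
        by_cases c2 : j = r + 1
        · subst c2; simp only; omega
        simpa [raise_of_ne L' c1 c2] using b3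
      · have b3 := h2 j hj
        rwa [raise_of_ne L' (by omega) (by omega)] at b3
      · exact ⟨fun _ => hLr, fun _ => rfl⟩
      · rw [typeAAct_of_eq (Fin.val_last r), if_pos (by omega), ha1]
      · simp only
        rw [sum_raise r (r + 2) (by omega)]
        omega
    · refine ⟨Fin.last r, (L, a - 1), ⟨h1, h2, ?_, by simp only; omega⟩, ?_, ?_⟩
      · simp only; omega
      · rw [typeAAct_of_eq (Fin.val_last r), if_neg (by omega), if_pos (by omega),
          Nat.sub_add_cancel (by omega)]
      · simp only; omega

theorem exists_actWord_eq {x : (ℕ → ℕ) × ℕ} (hx : x ∈ typeAIndex r d) :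
    ∃ ω, actWord (typeAAct r d) ω (0, 0) = some x := by
  obtain ⟨n, hn⟩ : ∃ n, ∑ j ∈ Finset.range (r + 2), x.1 j + x.2 = n := ⟨_, rfl⟩
  induction n using Nat.strong_induction_on generalizing x with
  | _ n ih =>
    by_cases h0 : x = (0, 0)
    · exact ⟨[], by rw [h0]; rfl⟩
    · obtain ⟨i, y, hy, hyx, hlt⟩ := exists_typeAAct_eq hx h0
      obtain ⟨ω, hω⟩ := ih _ (hn ▸ hlt) hy rfl
      exact ⟨i :: ω, by rw [actWord_cons, hω]; exact hyx⟩

/-! ### The generators of `NC_A(n, d)` -/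

variable (k : Type*) [CommRing k] (r d)

/-- The generators of `NC_A(r + 1, d)` as a sequence. -/
noncomputable def genA (j : ℕ) : NCA k (r + 1) d :=
  if h : j < r + 1 then T k (typeA (r + 1) d) ⟨j, h⟩ else 1

theorem genA_val (i : Fin (r + 1)) : genA r d k i = T k (typeA (r + 1) d) i := by
  simp [genA, i.2]

theorem genA_last : genA r d k r = T k (typeA (r + 1) d) (Fin.last r) := by
  rw [← genA_val, Fin.val_last]

theorem typeA_braid {i j : Fin (r + 1)} (h : i.val + 1 = j.val) :
    (typeA (r + 1) d).m i j = (3 : ℕ) := by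
  have : i ≠ j := by rintro rfl; omega
  simp [typeA, this, h]

theorem typeA_comm {i j : Fin (r + 1)} (h : i.val + 2 ≤ j.val) :
    (typeA (r + 1) d).m i j = (2 : ℕ) := by
  have h1 : i ≠ j := by rintro rfl; omega
  have h2 : ¬ (i.val + 1 = j.val ∨ j.val + 1 = i.val) := by omega
  simp [typeA, h1, h2]

theorem typeA_diag {i : Fin (r + 1)} (h : i.val < r) : (typeA (r + 1) d).m i i = (2 : ℕ) := by
  simp [typeA, h.ne]

theorem typeA_last : (typeA (r + 1) d).m (Fin.last r) (Fin.last r) = (d : ℕ) := by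
  simp [typeA]

theorem isBraidSeq_genA : IsBraidSeq (genA r d k) (r + 1) where
  braid i hi := by
    have h := word_alternatingWord k (typeA (r + 1) d) ⟨i, by omega⟩ ⟨i + 1, hi⟩ 3
      (by simp) (typeA_braid r d rfl)
    simp only [CoxeterSystem.alternatingWord, List.concat_eq_append, List.nil_append,
      List.cons_append, word_cons, word_nil, mul_one] at h
    simp only [genA, hi, Nat.lt_of_succ_lt hi, dif_pos, mul_assoc]
    exact h.symm
  comm i j hij hj := by
    have hi : i < r + 1 := by omega
    have h := word_alternatingWord k (typeA (r + 1) d) ⟨i, hi⟩ ⟨j, hj⟩ 2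
      (by simp; omega) (typeA_comm r d hij)
    simp only [CoxeterSystem.alternatingWord, List.concat_eq_append, List.nil_append,
      List.cons_append, word_cons, word_nil, mul_one] at h
    simp only [genA, hi, hj, dif_pos]
    exact h

theorem genA_mul_self {j : ℕ} (hj : j < r) : genA r d k j * genA r d k j = 0 := by
  have h := T_pow_eq_zero k (typeA (r + 1) d) ⟨j, by omega⟩
  rw [typeA_diag r d (by simpa using hj), ENat.toNat_natCast, ← genA_val] at h
  rw [← h, pow_two]

theorem genA_last_pow : genA r d k r ^ d = 0 := by
  have h := T_pow_eq_zero k (typeA (r + 1) d) (Fin.last r)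
  rwa [typeA_last, ENat.toNat_natCast, ← genA_last] at h

/-- The normal words of `NC_A(r + 1, d)`. -/
noncomputable def nfA (x : (ℕ → ℕ) × ℕ) : NCA k (r + 1) d :=
  stair (genA r d k) x.1 r * genA r d k r ^ (x.2 - 1) * block (genA r d k) (r + 1) (x.1 (r + 1))

theorem nfA_of_le_one {x : (ℕ → ℕ) × ℕ} (h : x.2 ≤ 1) :
    nfA r d k x = stair (genA r d k) x.1 (r + 1) := by
  rw [nfA, Nat.sub_eq_zero_of_le h, pow_zero, mul_one, stair_succ]

theorem T_mul_nfA (i : Fin (r + 1)) {x : (ℕ → ℕ) × ℕ} (hx : x ∈ typeAIndex r d) :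
    T k (typeA (r + 1) d) i * nfA r d k x = (typeAAct r d i x).elim 0 (nfA r d k) := by
  obtain ⟨L, a⟩ := x
  obtain ⟨h1, h2, h3, h4⟩ := hx
  simp only at h1 h2 h3 h4
  have ht := isBraidSeq_genA r d k
  rw [← genA_val]
  obtain hi | hi : i.val < r ∨ i.val = r := by omega
  · rw [typeAAct_of_lt hi]
    split_ifs with hL
    · change _ = nfA r d k (raise i L, a)
      have h : raise i L (r + 1) = L (r + 1) := raise_of_ne L (by omega) (by omega)
      simp only [nfA, h]
      rw [← mul_assoc, ← mul_assoc, ht.mul_stair hi (by omega) (h1 i (by omega)) hL]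
    · rw [nfA, ← mul_assoc, ← mul_assoc, ht.mul_stair_eq_zero hi (by omega) (h1 _ (by omega))
        (genA_mul_self r d k hi) (not_le.1 hL), zero_mul, zero_mul]
      rfl
  · rw [typeAAct_of_eq hi, hi]
    split_ifs with hL hL'
    · change _ = nfA r d k (raise r L, 1)
      rw [nfA_of_le_one r d k hL.1, nfA_of_le_one r d k le_rfl]
      exact ht.mul_stair (Nat.lt_succ_self r) le_rfl (h1 r (by omega)) hL.2
    · change _ = nfA r d k (L, a + 1)
      obtain ⟨b, rfl⟩ : ∃ b, a = b + 1 := ⟨a - 1, by omega⟩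
      simp only [nfA, Nat.add_sub_cancel]
      rw [← mul_assoc, ← mul_assoc, (ht.commute_stair_of_eq_zero hL'.1 (Nat.lt_succ_self r)).eq,
        pow_succ' _ b]
      simp only [mul_assoc]
    · change _ = 0
      obtain ⟨b, hb⟩ : ∃ b, L (r + 1) = b + 1 := ⟨L (r + 1) - 1, by omega⟩
      obtain ⟨e, rfl⟩ : ∃ e, a = e + 1 := ⟨a - 1, by omega⟩
      simp only [nfA, Nat.add_sub_cancel]
      -- If the `r`-th block is empty, the last generator commutes with the stair and its `d`-th
      -- power appears.
      obtain hr0 | hr0 := Nat.eq_zero_or_pos (L r)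
      · have he : d = e + 1 + 1 := by omega
        have hpow := genA_last_pow r d k
        rw [he, pow_succ, pow_succ', ← he] at hpow
        rw [← mul_assoc, ← mul_assoc, (ht.commute_stair_of_eq_zero hr0 (Nat.lt_succ_self r)).eq, hb,
          block_succ, ← mul_assoc, mul_assoc (stair _ _ _), mul_assoc (stair _ _ _), hpow, mul_zero,
          zero_mul]
      -- Otherwise the last generator lengthens the nonempty `r`-th block. For `a = 1` it meets a
      -- longer block and the product vanishes; for `a ≥ 2`, two copies of `T_n` pass leftwards
      -- through it and become `T_{n-1}^2 = 0`.
      · obtain ⟨q, rfl⟩ : ∃ q, r = q + 1 := ⟨r - 1, by have := h1 r (by omega); omega⟩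
        have hLr := h1 (q + 1) (by omega)
        rw [stair_succ, ← mul_assoc, ← mul_assoc, ← mul_assoc,
          (ht.commute_stair L (Nat.lt_succ_self q) (Nat.lt_succ_self _)).eq,
          mul_assoc (stair _ _ _), ← block_succ]
        cases e with
        | zero =>
          rw [pow_zero, mul_one, mul_assoc, ht.block_mul_block_eq_zero (by omega) le_rfl (by omega)
            (genA_mul_self _ _ _ (by omega)), mul_zero]
        | succ e =>
          have h5 := ht.block_mul_succ (q := q + 1 + 1) (l := L (q + 1) + 1) (j := q) (by omega)
            le_rfl (by omega) le_rfl
          have h6 : block (genA (q + 1) d k) (q + 1 + 1) (L (q + 1) + 1) *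
              (genA (q + 1) d k (q + 1) ^ (e + 1) * genA (q + 1) d k (q + 1)) = 0 := by
            rw [← pow_succ, pow_succ', pow_succ', ← mul_assoc, ← mul_assoc, h5,
              mul_assoc (genA _ _ _ q), h5, ← mul_assoc, genA_mul_self _ _ _ (Nat.lt_succ_self q),
              zero_mul, zero_mul]
          rw [hb, block_succ _ (q + 1) b, ← mul_assoc, mul_assoc (stair _ _ _),
            mul_assoc (stair _ _ _), mul_assoc (block _ _ _), h6, mul_zero, zero_mul]

/-- The basis of `NC_A(r + 1, d)`. -/
noncomputable def typeANormalForm (hd : 2 ≤ d) :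
    NormalForm k (typeA (r + 1) d) ((ℕ → ℕ) × ℕ) where
  act := typeAAct r d
  V := typeAIndex r d
  base := (0, 0)
  nf := nfA r d k
  braid i j a hij ha x := by
    wlog hlt : i < j generalizing i j
    · exact (this j i hij.symm ((typeA (r + 1) d).symm j i ▸ ha)
        (lt_of_le_of_ne (not_lt.1 hlt) hij.symm)).symm
    obtain h | h : i.val + 1 = j.val ∨ i.val + 2 ≤ j.val := by omega
    · obtain rfl : 3 = a := by rw [typeA_braid r d h] at ha; exact_mod_cast ha
      simp only [CoxeterSystem.alternatingWord, List.concat_eq_append, List.nil_append,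
        List.cons_append, actWord_cons, actWord_nil, Option.bind_some]
      exact (typeAAct_braid h x).symm
    · obtain rfl : 2 = a := by rw [typeA_comm r d h] at ha; exact_mod_cast ha
      simp only [CoxeterSystem.alternatingWord, List.concat_eq_append, List.nil_append,
        List.cons_append, actWord_cons, actWord_nil, Option.bind_some]
      exact (typeAAct_comm h x).symm
  order i x := by
    obtain hi | hi : i.val < r ∨ i = Fin.last r := by
      rw [Fin.ext_iff, Fin.val_last]; omega
    · rw [typeA_diag r d hi, ENat.toNat_natCast]
      obtain ⟨L, a⟩ := x
      change ((some (L, a)).bind (typeAAct r d i)).bind (typeAAct r d i) = none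
      rw [Option.bind_some, typeAAct_of_lt hi]
      split_ifs with h
      · rw [Option.bind_some, typeAAct_of_lt hi, raise_self, raise_succ, if_neg (by omega)]
      · rfl
    · subst hi
      rw [typeA_last, ENat.toNat_natCast]
      obtain ⟨e, rfl⟩ : ∃ e, d = e + 1 := ⟨d - 1, by omega⟩
      cases h : actWord (typeAAct r (e + 1)) (List.replicate (e + 1) (Fin.last r)) x with
      | none => rfl
      | some y =>
        have := typeAAct_replicate_last hd e x y h
        omega
  base_mem := ⟨fun j _ => Nat.zero_le j, fun _ _ => rfl, by simp, by simp; omega⟩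
  nf_base := by
    have : ∀ q, stair (genA r d k) 0 q = 1 := fun q => by
      induction q with
      | zero => rfl
      | succ q ih => rw [stair_succ, ih, Pi.zero_apply, block_zero_right, mul_one]
    rw [nfA_of_le_one r d k (Nat.zero_le _), this]
  act_mem i x hx y h := typeAAct_mem hd i hx h
  act_inj i x hx y hy z h h' := typeAAct_inj i hx hy h h'
  T_mul_nf i x hx := T_mul_nfA r d k i hx
  reach x hx := exists_actWord_eq hx

end TypeA

end GenCoxeterMatrix

/-! ### Longest words in the symmetric group -/

/-- The sequences of block lengths indexing the elements of the symmetric group `S_{r+1}`. -/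
def stairIndex (r : ℕ) : Set (ℕ → ℕ) := {L | (∀ j ≤ r, L j ≤ j) ∧ ∀ j, r < j → L j = 0}

/-- The adjacent transpositions as a sequence. -/
def adjSwapSeq (r j : ℕ) : Equiv.Perm (Fin (r + 1)) :=
  if h : j < r then adjSwap r ⟨j, h⟩ else 1

theorem adjSwapSeq_val {r : ℕ} (i : Fin r) : adjSwapSeq r i = adjSwap r i := by
  simp [adjSwapSeq]

theorem adjSwap_mul_self {r : ℕ} (i : Fin r) : adjSwap r i * adjSwap r i = 1 :=
  Equiv.swap_mul_self _ _

theorem isBraidSeq_adjSwapSeq (r : ℕ) : IsBraidSeq (adjSwapSeq r) r where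
  braid i hi := by
    have hi' : i < r := by omega
    simp only [adjSwapSeq, hi, hi', dif_pos, adjSwap]
    have e : (⟨i + 1, hi⟩ : Fin r).castSucc = (⟨i, hi'⟩ : Fin r).succ := rfl
    have h1 : (⟨i, hi'⟩ : Fin r).castSucc ≠ (⟨i, hi'⟩ : Fin r).succ := by simp [Fin.ext_iff]
    have h2 : (⟨i + 1, hi⟩ : Fin r).succ ≠ (⟨i, hi'⟩ : Fin r).succ := by simp [Fin.ext_iff]
    have h3 : (⟨i, hi'⟩ : Fin r).castSucc ≠ (⟨i + 1, hi⟩ : Fin r).succ := by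
      simp [Fin.ext_iff]; omega
    have k1 := Equiv.swap_mul_swap_mul_swap h1 h3
    have k2 := Equiv.swap_mul_swap_mul_swap h2 h3.symm
    rw [Equiv.swap_comm _ (⟨i, hi'⟩ : Fin r).castSucc,
      Equiv.swap_comm (⟨i + 1, hi⟩ : Fin r).succ] at k2
    rw [e, k1, k2, Equiv.swap_comm]
  comm i j hij hj := by
    have hi : i < r := by omega
    simp only [adjSwapSeq, hi, hj, dif_pos, adjSwap]
    refine (Equiv.Perm.disjoint_swap_swap ?_).commute.eq
    simp [Fin.ext_iff]
    omega

theorem exists_word_block {r q l : ℕ} (hq : q ≤ r) (hl : l ≤ q) :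
    ∃ ω : List (Fin r), (ω.map (adjSwap r)).prod = block (adjSwapSeq r) q l ∧ ω.length = l := by
  induction q generalizing l with
  | zero =>
    obtain rfl : l = 0 := by omega
    exact ⟨[], rfl, rfl⟩
  | succ q ih =>
    cases l with
    | zero => exact ⟨[], rfl, rfl⟩
    | succ l =>
      obtain ⟨ω, h, hlen⟩ := ih (l := l) (by omega) (by omega)
      refine ⟨⟨q, by omega⟩ :: ω, ?_, by simp [hlen]⟩
      rw [List.map_cons, List.prod_cons, h, block_succ, ← adjSwapSeq_val]

theorem exists_word_stair {r q : ℕ} (hq : q ≤ r) {L : ℕ → ℕ} (hL : L ∈ stairIndex r) :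
    ∃ ω : List (Fin r), (ω.map (adjSwap r)).prod = stair (adjSwapSeq r) L q ∧
      ω.length = ∑ j ∈ Finset.range (q + 1), L j := by
  induction q with
  | zero =>
    have := hL.1 0 (Nat.zero_le _)
    exact ⟨[], rfl, by simp; omega⟩
  | succ q ih =>
    obtain ⟨ω, h, hlen⟩ := ih (by omega)
    obtain ⟨ω', h', hlen'⟩ := exists_word_block hq (hL.1 (q + 1) hq)
    exact ⟨ω ++ ω', by rw [List.map_append, List.prod_append, h, h', stair_succ],
      by rw [List.length_append, hlen, hlen', Finset.sum_range_succ _ (q + 1)]⟩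

theorem wordLength_le {I G : Type*} [Monoid G] (s : I → G) (ω : List I) :
    wordLength s (ω.map s).prod ≤ ω.length :=
  Nat.sInf_le ⟨ω, rfl, rfl⟩

theorem exists_word_length_eq_wordLength {I G : Type*} [Monoid G] (s : I → G) (ω : List I) :
    ∃ ω' : List I, (ω'.map s).prod = (ω.map s).prod ∧
      ω'.length = wordLength s (ω.map s).prod :=
  Nat.sInf_mem (s := {l | ∃ ω' : List I, (ω'.map s).prod = (ω.map s).prod ∧ ω'.length = l})
    ⟨_, ω, rfl, rfl⟩

theorem raise_mem_stairIndex {r i : ℕ} (hi : i < r) {L : ℕ → ℕ} (hL : L ∈ stairIndex r)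
    (h : L (i + 1) ≤ L i) : raise i L ∈ stairIndex r := by
  have h1 := hL.1 i hi.le
  refine ⟨fun j hj => ?_, fun j hj => ?_⟩
  · have := hL.1 j hj
    simp only [raise]
    split_ifs <;> omega
  · rw [raise_of_ne L (by omega) (by omega), hL.2 j hj]

theorem lower_mem_stairIndex {r i : ℕ} (hi : i < r) {L : ℕ → ℕ} (hL : L ∈ stairIndex r)
    (h : L i < L (i + 1)) : lower i L ∈ stairIndex r := by
  have h1 := hL.1 i hi.le
  have h2 := hL.1 (i + 1) hi
  refine ⟨fun j hj => ?_, fun j hj => ?_⟩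
  · have := hL.1 j hj
    simp only [lower]
    split_ifs <;> omega
  · rw [lower_of_ne L (by omega) (by omega), hL.2 j hj]

namespace GenCoxeterMatrix

/-- The element of the symmetric group defined by a word is a normal form, of length at most that
of the word, and with equality only if the word acts by raising the block lengths. -/
theorem exists_stair_eq (r d : ℕ) (ω : List (Fin r)) : ∃ L ∈ stairIndex r,
    (ω.map (adjSwap r)).prod = stair (adjSwapSeq r) L r ∧
    ∑ j ∈ Finset.range (r + 1), L j ≤ ω.length ∧
    (∑ j ∈ Finset.range (r + 1), L j = ω.length →
      actWord (typeAAct r d) (ω.map Fin.castSucc) (0, 0) = some (L, 0)) := by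
  have ht := isBraidSeq_adjSwapSeq r
  induction ω with
  | nil =>
    have : ∀ q, stair (adjSwapSeq r) 0 q = 1 := fun q => by
      induction q with
      | zero => rfl
      | succ q ih => rw [stair_succ, ih, Pi.zero_apply, block_zero_right, mul_one]
    exact ⟨0, ⟨fun _ _ => Nat.zero_le _, fun _ _ => rfl⟩, (this r).symm, by simp, fun _ => rfl⟩
  | cons i ω ih =>
    obtain ⟨L, hL, h1, h2, h3⟩ := ih
    rw [List.map_cons, List.prod_cons, h1, ← adjSwapSeq_val]
    have hi := i.2
    by_cases h : L (i + 1) ≤ L i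
    · refine ⟨raise i L, raise_mem_stairIndex hi hL h,
        ht.mul_stair hi le_rfl (hL.1 i hi.le) h, ?_, fun he => ?_⟩
      · rw [sum_raise i (r + 1) (by omega), List.length_cons]
        omega
      · rw [sum_raise i (r + 1) (by omega), List.length_cons] at he
        rw [List.map_cons, actWord_cons, h3 (by omega), Option.bind_some,
          typeAAct_of_lt (by simp), Fin.val_castSucc, if_pos h]
    -- At an ascent the involution `s_i` undoes a `raise`, so the sum drops and the equality clause
    -- is vacuous.
    · rw [not_le] at h
      have hr := raise_lower h
      have hlow := lower_mem_stairIndex hi hL h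
      have hsum := sum_raise i (r + 1) (by omega) (lower i L)
      rw [hr] at hsum
      refine ⟨lower i L, hlow, ?_, ?_, fun he => ?_⟩
      · have := hL.1 (i + 1) hi
        have := ht.mul_stair hi le_rfl (hlow.1 i hi.le) (by rw [lower_self, lower_succ]; omega)
        rw [hr] at this
        rw [← this, ← mul_assoc, adjSwapSeq_val, adjSwap_mul_self, one_mul]
      · rw [List.length_cons]; omega
      · rw [List.length_cons] at he; omega

end GenCoxeterMatrix

theorem exists_word_adjSwap {r : ℕ} (g : Equiv.Perm (Fin (r + 1))) :
    ∃ ω : List (Fin r), (ω.map (adjSwap r)).prod = g := by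
  have h : g ∈ Submonoid.closure (Set.range (adjSwap r)) := by
    have := Equiv.Perm.mclosure_swap_castSucc_succ r
    change Submonoid.closure (Set.range (adjSwap r)) = ⊤ at this
    rw [this]
    trivial
  induction h using Submonoid.closure_induction with
  | mem x h => obtain ⟨i, rfl⟩ := h; exact ⟨[i], by simp⟩
  | one => exact ⟨[], rfl⟩
  | mul x y _ _ hx hy =>
    obtain ⟨ω, rfl⟩ := hx
    obtain ⟨ω', rfl⟩ := hy
    exact ⟨ω ++ ω', by simp⟩

/-- There are `(r + 1)!` admissible sequences, as many as permutations, and every permutation is a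
stair by `exists_stair_eq`; a surjection between finite sets of equal size is injective. -/
theorem stair_adjSwapSeq_injOn (r : ℕ) :
    Set.InjOn (fun L => stair (adjSwapSeq r) L r) (stairIndex r) := by
  let F : ((j : Fin (r + 1)) → Fin (j.val + 1)) → Equiv.Perm (Fin (r + 1)) := fun f =>
    stair (adjSwapSeq r) (fun j => if h : j < r + 1 then f ⟨j, h⟩ else 0) r
  have hlift : ∀ L ∈ stairIndex r, ∃ f : (j : Fin (r + 1)) → Fin (j.val + 1),
      (fun j => if h : j < r + 1 then (f ⟨j, h⟩ : ℕ) else 0) = L := by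
    intro L hL
    refine ⟨fun j => ⟨L j, Nat.lt_succ_of_le (hL.1 j (Nat.le_of_lt_succ j.2))⟩, ?_⟩
    funext j
    split_ifs with h
    · rfl
    · exact (hL.2 j (by omega)).symm
  have hsurj : Function.Surjective F := by
    intro g
    obtain ⟨ω, rfl⟩ := exists_word_adjSwap g
    obtain ⟨L, hL, h, -⟩ := GenCoxeterMatrix.exists_stair_eq r 0 ω
    obtain ⟨f, hf⟩ := hlift L hL
    exact ⟨f, by rw [h, ← hf]⟩
  have hcard : Fintype.card ((j : Fin (r + 1)) → Fin (j.val + 1)) =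
      Fintype.card (Equiv.Perm (Fin (r + 1))) := by
    rw [Fintype.card_pi, Fintype.card_perm, Fintype.card_fin, ← Finset.prod_range_add_one_eq_factorial,
      ← Fin.prod_univ_eq_prod_range (fun j => j + 1)]
    simp
  have hinj := ((Fintype.bijective_iff_surjective_and_card F).2 ⟨hsurj, hcard⟩).1
  intro L hL L' hL' h
  obtain ⟨f, rfl⟩ := hlift L hL
  obtain ⟨f', rfl⟩ := hlift L' hL'
  rw [hinj (a₁ := f) (a₂ := f') h]

/-- The sequence of block lengths of the longest element. -/
def maxStair (r b j : ℕ) : ℕ := if j ≤ r then j else if j = r + 1 then b else 0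

theorem maxStair_of_le {r j : ℕ} (b : ℕ) (h : j ≤ r) : maxStair r b j = j := by simp [maxStair, h]

theorem maxStair_succ (r b : ℕ) : maxStair r b (r + 1) = b := by simp [maxStair]

theorem maxStair_mem (r : ℕ) : maxStair r 0 ∈ stairIndex r :=
  ⟨fun j hj => (maxStair_of_le 0 hj).le, fun j hj => by simp [maxStair, hj.not_ge]⟩

/-- A reduced word has as many letters as the sum of its block lengths. By uniqueness of stairs the
permutation with full blocks has length at least the sum of all `j ≤ r`, so a word of maximal length
must have full blocks. -/
theorem IsLongestWord.actWord_eq {r : ℕ} (d : ℕ) {ω : List (Fin r)} (hω : IsLongestWord r ω) :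
    ∃ L ∈ stairIndex r, (∀ j ≤ r, L j = j) ∧
      actWord (GenCoxeterMatrix.typeAAct r d) (ω.map Fin.castSucc) (0, 0) = some (L, 0) := by
  obtain ⟨h1, h2⟩ := hω
  obtain ⟨L, hL, e1, e2, e3⟩ := GenCoxeterMatrix.exists_stair_eq r d ω
  obtain ⟨ω₁, f1, f2⟩ := exists_word_stair le_rfl hL
  have h3 := wordLength_le (adjSwap r) ω₁
  rw [f1, ← e1, h1, f2] at h3
  obtain ⟨ω₂, g1, g2⟩ := exists_word_stair le_rfl (maxStair_mem r)
  obtain ⟨ω₃, g3, g4⟩ := exists_word_length_eq_wordLength (adjSwap r) ω₂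
  obtain ⟨L', hL', i1, i2, -⟩ := GenCoxeterMatrix.exists_stair_eq r d ω₃
  have hLL : L' = maxStair r 0 :=
    stair_adjSwapSeq_injOn r hL' (maxStair_mem r) (i1.symm.trans (g3.trans g1))
  have h4 := h2 (ω₂.map (adjSwap r)).prod
  rw [← g4] at h4
  rw [hLL] at i2
  refine ⟨L, hL, ?_, e3 (le_antisymm e2 h3)⟩
  by_contra hne
  push Not at hne
  obtain ⟨j, hj, hne⟩ := hne
  have hlt : ∑ j ∈ Finset.range (r + 1), L j < ∑ j ∈ Finset.range (r + 1), maxStair r 0 j := by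
    refine Finset.sum_lt_sum (fun i hi => ?_) ⟨j, Finset.mem_range.2 (by omega), ?_⟩
    · rw [Finset.mem_range] at hi
      rw [maxStair_of_le 0 (by omega)]
      exact hL.1 i (by omega)
    · rw [maxStair_of_le 0 hj]
      exact lt_of_le_of_ne (hL.1 j hj) hne
  omega

/-! ### Primitive elements of `NC_A(n, d)` -/

namespace GenCoxeterMatrix

variable (r d : ℕ) (k : Type*) [CommRing k]

/-- The word `T_{w'} T_n^a T_{n-1} ⋯ T_m` of `NC_A(n, d)`, for `n = r + 1` and `w'` the longest
element of the symmetric group `S_n`, with `m` counted from `0`. -/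
noncomputable def primWord (a m : ℕ) : NCA k (r + 1) d :=
  stair (genA r d k) id r * genA r d k r ^ a * block (genA r d k) r (r - m)

theorem prod_reverse_filter_range {G : Type*} [Monoid G] (t : ℕ → G) (q m : ℕ) :
    ((((List.range q).filter fun j => m ≤ j).reverse).map t).prod = block t q (q - m) := by
  induction q with
  | zero => simp [block]
  | succ q ih =>
    rw [List.range_succ, List.filter_append, List.reverse_append, List.map_append,
      List.prod_append, ih]
    by_cases h : m ≤ q
    · rw [Nat.sub_add_comm h, block_succ]
      simp [h]
    · rw [Nat.sub_eq_zero_of_le (by omega), Nat.sub_eq_zero_of_le (by omega), block_zero_right,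
        block_zero_right]
      simp [h]

theorem word_eq_prod_genA (ω : List (Fin (r + 1))) :
    word k (typeA (r + 1) d) ω = ((ω.map Fin.val).map (genA r d k)).prod := by
  rw [word, List.map_map]
  congr 1
  exact List.map_congr_left fun i _ => (genA_val r d k i).symm

theorem word_reverse_filter (m : Fin (r + 1)) :
    word k (typeA (r + 1) d)
      (((List.finRange r).map Fin.castSucc).filter fun j => m ≤ j).reverse =
      block (genA r d k) r (r - m) := by
  rw [word_eq_prod_genA, ← prod_reverse_filter_range, List.map_reverse]
  congr 3
  rw [← List.map_coe_finRange_eq_range, List.filter_map, List.filter_map, List.map_map]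
  rfl

theorem _root_.IsLongestWord.word_eq (hd : 2 ≤ d) {ω : List (Fin r)} (hω : IsLongestWord r ω) :
    word k (typeA (r + 1) d) (ω.map Fin.castSucc) = stair (genA r d k) id r := by
  obtain ⟨L, hL, h1, h2⟩ := hω.actWord_eq d
  have h := (typeANormalForm r d k hd).word_eq (ω.map Fin.castSucc)
  have h3 : actWord (typeANormalForm r d k hd).act (ω.map Fin.castSucc)
      (typeANormalForm r d k hd).base = some (L, 0) := h2
  rw [h3] at h
  rw [h]
  change nfA r d k (L, 0) = _
  rw [nfA_of_le_one r d k (Nat.zero_le _)]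
  simp only [stair_succ, hL.2 (r + 1) (Nat.lt_succ_self r), block_zero_right, mul_one]
  exact stair_congr _ fun j _ hj => h1 j hj

theorem stdWord_eq_primWord (hd : 2 ≤ d) {ω : List (Fin r)} (hω : IsLongestWord r ω) (a : ℕ)
    (m : Fin (r + 1)) : stdWord k r d ω a m = primWord r d k a m := by
  rw [stdWord, primWord, hω.word_eq r d k hd, word_reverse_filter, ← genA_last]

/-- The index of the basis element `primWord r d k a m`. -/
def primIndex (a m : ℕ) : (ℕ → ℕ) × ℕ := (maxStair r (r + 1 - m), a)

variable {r d}

theorem primIndex_mem {a m : ℕ} (ha : 1 ≤ a) (had : a < d) (hm : m ≤ r) :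
    primIndex r a m ∈ typeAIndex r d := by
  refine ⟨fun j hj => ?_, fun j hj => ?_, ?_, had⟩
  · simp only [primIndex, maxStair]
    split_ifs <;> omega
  · simp only [primIndex, maxStair]
    split_ifs <;> omega
  · simp only [primIndex, maxStair_succ]
    omega

theorem primIndex_injective {a a' m m' : ℕ} (hm : m ≤ r) (hm' : m' ≤ r)
    (h : primIndex r a m = primIndex r a' m') : a = a' ∧ m = m' := by
  simp only [primIndex, Prod.mk.injEq] at h
  have := congrFun h.1 (r + 1)
  rw [maxStair_succ, maxStair_succ] at this
  omega

theorem nfA_primIndex {a m : ℕ} (ha : 1 ≤ a) (hm : m ≤ r) :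
    nfA r d k (primIndex r a m) = primWord r d k a m := by
  obtain ⟨a, rfl⟩ : ∃ b, a = b + 1 := ⟨a - 1, by omega⟩
  simp only [nfA, primIndex, maxStair_succ, Nat.add_sub_cancel, primWord]
  rw [stair_congr (L := maxStair r (r + 1 - m)) (L' := id) _ fun j _ hj => maxStair_of_le _ hj, Nat.sub_add_comm hm, block_succ,
    pow_succ]
  simp only [mul_assoc]

/-- If the generators before the last do not act, `L` strictly increases up to `r`, and `L j ≤ j`
forces `L j = j`. The last one does not raise iff `a ≥ 2` or the last block is full, i.e. `m = 0`.
It can increase the exponent only if `L r = r = 0`, whence the final clause. -/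
theorem typeAAct_eq_none_iff {x : (ℕ → ℕ) × ℕ} (hx : x ∈ typeAIndex r d) :
    (∀ i, typeAAct r d i x = none) ↔ ∃ a m, x = primIndex r a m ∧ 1 ≤ a ∧ a < d ∧ m ≤ r ∧
      (a = 1 → m = 0) ∧ (r = 0 → a + 1 = d) := by
  constructor
  · obtain ⟨L, a⟩ := x
    obtain ⟨h1, h2, h3, h4⟩ := hx
    simp only at h1 h2 h3 h4
    intro h
    have hL : ∀ j ≤ r, L j = j := by
      intro j hj
      induction j with
      | zero => simpa using h1 0 (Nat.zero_le _)
      | succ j ih =>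
        have h5 := h ⟨j, by omega⟩
        rw [typeAAct_of_lt (by simpa using hj)] at h5
        split_ifs at h5 with h6
        have := h1 (j + 1) (by omega)
        have := ih (by omega)
        simp only at h6
        omega
    have hlast := h (Fin.last r)
    rw [typeAAct_of_eq (Fin.val_last r)] at hlast
    split_ifs at hlast with h5 h6
    have h7 := hL r le_rfl
    have h8 := h1 (r + 1) le_rfl
    refine ⟨a, r + 1 - L (r + 1), ?_, by omega, h4, by omega, by omega, by omega⟩
    rw [primIndex, Prod.mk.injEq]
    refine ⟨?_, rfl⟩
    funext j
    simp only [maxStair]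
    split_ifs with e1 e2
    · exact hL j e1
    · subst e2; omega
    · exact h2 j (by omega)
  · rintro ⟨a, m, rfl, ha, had, hm, ham, hr⟩ i
    obtain hi | hi : i.val < r ∨ i.val = r := by omega
    · rw [primIndex, typeAAct_of_lt hi, maxStair_of_le _ (by omega), maxStair_of_le _ (by omega),
        if_neg (by omega)]
    · rw [primIndex, typeAAct_of_eq hi, maxStair_of_le _ le_rfl, maxStair_succ,
        if_neg (by omega), if_neg (by omega)]

theorem mem_leftPrimIndex {p : ℕ × Fin (r + 1)} :
    p ∈ leftPrimIndex r d ↔ p = (1, 0) ∨ 2 ≤ p.1 ∧ p.1 ≤ d - 1 := by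
  simp [leftPrimIndex]

theorem primL_typeA (hr : 1 ≤ r) (hd : 2 ≤ d) : primL k (typeA (r + 1) d) =
    Submodule.span k ((fun p : ℕ × Fin (r + 1) => primWord r d k p.1 p.2) ''
      (leftPrimIndex r d : Set (ℕ × Fin (r + 1)))) := by
  rw [(typeANormalForm r d k hd).primL_eq]
  congr 1
  ext y
  constructor
  · rintro ⟨x, ⟨hx, hdead⟩, rfl⟩
    obtain ⟨a, m, rfl, ha, had, hm, ham, -⟩ := (typeAAct_eq_none_iff hx).1 hdead
    refine ⟨(a, ⟨m, by omega⟩), ?_, (nfA_primIndex k ha hm).symm⟩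
    rw [Finset.mem_coe, mem_leftPrimIndex]
    by_cases h : a = 1
    · left
      obtain rfl := ham h
      rw [h]
      rfl
    · right
      simp only
      omega
  · rintro ⟨⟨a, m⟩, hp, rfl⟩
    rw [Finset.mem_coe, mem_leftPrimIndex, Prod.mk.injEq, Fin.ext_iff] at hp
    simp only [Fin.val_zero] at hp
    have hm : m.val ≤ r := by omega
    have ha : 1 ≤ a ∧ a < d ∧ (a = 1 → m.val = 0) := by omega
    have hmem := primIndex_mem ha.1 ha.2.1 hm
    exact ⟨_, ⟨hmem, (typeAAct_eq_none_iff hmem).2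
      ⟨a, m, rfl, ha.1, ha.2.1, hm, ha.2.2, by omega⟩⟩, nfA_primIndex k ha.1 hm⟩

theorem linearIndepOn_primWord (hd : 2 ≤ d) {s : Set (ℕ × Fin (r + 1))}
    (hs : ∀ p ∈ s, 1 ≤ p.1 ∧ p.1 < d) :
    LinearIndepOn k (fun p : ℕ × Fin (r + 1) => primWord r d k p.1 p.2) s := by
  have h := (typeANormalForm r d k hd).linearIndepOn
  have h1 : LinearIndepOn k (nfA r d k ∘ fun p : ℕ × Fin (r + 1) => primIndex r p.1 p.2) s := by
    refine LinearIndepOn.comp_of_image (h.mono ?_) ?_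
    · rintro _ ⟨p, hp, rfl⟩
      exact primIndex_mem (hs p hp).1 (hs p hp).2 (by omega)
    · intro p _ q _ hpq
      obtain ⟨h2, h3⟩ := primIndex_injective (by omega) (by omega) hpq
      exact Prod.ext h2 (Fin.ext h3)
  exact h1.congr fun p hp => nfA_primIndex k (hs p hp).1 (by omega)

variable (r d)

theorem genA_mul_stair {j : ℕ} (hj : j < r) :
    genA r d k j * stair (genA r d k) id r = 0 :=
  (isBraidSeq_genA r d k).mul_stair_eq_zero hj (Nat.le_succ r) le_rfl (genA_mul_self r d k hj)
    (Nat.lt_succ_self j)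

namespace IsAntiInvolution

variable {r d k} {θ : NCA k (r + 1) d →ₗ[k] NCA k (r + 1) d}
  (hθ : IsAntiInvolution k (typeA (r + 1) d) θ)
include hθ

theorem map_genA (j : ℕ) : θ (genA r d k j) = genA r d k j := by
  rw [genA]
  split_ifs
  · exact hθ.map_T _
  · exact hθ.map_one

theorem map_block (q : ℕ) :
    θ (block (genA r d k) q q) = ((List.range q).map (genA r d k)).prod := by
  induction q with
  | zero => exact hθ.map_one
  | succ q ih =>
    rw [block_succ, hθ.map_mul, ih, hθ.map_genA, List.range_succ, List.map_append,
      List.prod_append, List.map_singleton, List.prod_singleton]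

theorem map_stair {q : ℕ} (hq : q ≤ r + 1) :
    θ (stair (genA r d k) id q) = stair (genA r d k) id q := by
  induction q with
  | zero => exact hθ.map_one
  | succ q ih =>
    rw [stair_succ, hθ.map_mul, ih (by omega), id, hθ.map_block,
      ← (isBraidSeq_genA r d k).stair_id_succ hq, stair_succ, id]

theorem map_pow_genA (j a : ℕ) : θ (genA r d k j ^ a) = genA r d k j ^ a := by
  induction a with
  | zero => simpa using hθ.map_one
  | succ a ih => rw [pow_succ, hθ.map_mul, ih, hθ.map_genA, ← pow_succ', pow_succ]

/-- Reversal gives `T_1 ⋯ T_{n-1} T_n^a` times the full stair. The stair without its last block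
commutes with `T_n`, and moved to the left of `T_n^a` it completes `T_1 ⋯ T_{n-1}` to a full stair
by `stair_id_succ`. -/
theorem map_primWord (a : ℕ) : θ (primWord r d k a 0) = primWord r d k a 0 := by
  have ht := isBraidSeq_genA r d k
  rw [primWord, Nat.sub_zero, hθ.map_mul, hθ.map_mul, hθ.map_stair (Nat.le_succ r),
    hθ.map_pow_genA, hθ.map_block]
  cases r with
  | zero => simp [stair, block]
  | succ q =>
    nth_rw 2 [ht.stair_id_succ (Nat.le_succ _)]
    have hc := ((ht.commute_stair id (Nat.lt_succ_self q) (Nat.lt_succ_self _)).pow_left a).eq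
    rw [stair_succ, id, ← mul_assoc _ (stair _ _ _), hc]
    simp only [mul_assoc]

end IsAntiInvolution

theorem stair_mul_genA {j : ℕ} (hj : j < r) :
    stair (genA r d k) id r * genA r d k j = 0 := by
  obtain ⟨θ, hθ⟩ := exists_isAntiInvolution k (typeA (r + 1) d)
  rw [← hθ.map_genA j, ← hθ.map_stair (Nat.le_succ r), ← hθ.map_mul, genA_mul_stair r d k hj,
    map_zero]

theorem stair_mul_pow_mul_genA {j : ℕ} (hj : j + 2 ≤ r) (a : ℕ) :
    stair (genA r d k) id r * genA r d k r ^ a * genA r d k j = 0 := by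
  have h : Commute (genA r d k j) (genA r d k r) :=
    (isBraidSeq_genA r d k).comm j r hj (Nat.lt_succ_self r)
  rw [mul_assoc, ← (h.pow_right a).eq, ← mul_assoc, stair_mul_genA r d k (by omega), zero_mul]

/-- A letter just below the end of the tail extends it, and one equal to its end gives a square. Any
other passes through the tail, unchanged or with its index lowered, then through the power of `T_n`,
and is absorbed by the full stair. -/
theorem primWord_mul_genA {j m : ℕ} (hj : j < r) (hm : m ≤ r) (a : ℕ) :
    primWord r d k a m * genA r d k j = if m = j + 1 then primWord r d k a j else 0 := by
  have ht := isBraidSeq_genA r d k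
  have hsucc : block (genA r d k) r (r - j) =
      block (genA r d k) r (r - (j + 1)) * genA r d k j := by
    have h := block_succ_right (genA r d k) j (r - (j + 1))
    rwa [show j + 1 + (r - (j + 1)) = r by omega, show r - (j + 1) + 1 = r - j by omega] at h
  rw [primWord, mul_assoc]
  obtain h | rfl | rfl | h : j + 1 < m ∨ m = j + 1 ∨ m = j ∨ m < j := by omega
  · rw [if_neg (by omega), ← (ht.commute_block_of_add_lt (by omega) (Nat.le_succ r)).eq,
      ← mul_assoc, stair_mul_pow_mul_genA r d k (by omega), zero_mul]
  · rw [if_pos rfl, ← hsucc, primWord]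
  · rw [if_neg (by omega), hsucc, mul_assoc (block _ _ _), genA_mul_self r d k hj, mul_zero,
      mul_zero]
  · obtain ⟨i, rfl⟩ : ∃ i, j = i + 1 := ⟨j - 1, by omega⟩
    rw [if_neg (by omega), ht.block_mul_succ (by omega) (Nat.le_succ r) (by omega) (by omega),
      ← mul_assoc, stair_mul_pow_mul_genA r d k (by omega), zero_mul]

variable {r d}

theorem prim_typeA (hr : 1 ≤ r) (hd : 2 ≤ d) : prim k (typeA (r + 1) d) =
    Submodule.span k ((fun a => primWord r d k a 0) '' Set.Icc 1 (d - 1)) := by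
  apply le_antisymm
  · rintro x ⟨hxL, hxR⟩
    rw [primL_typeA k hr hd] at hxL
    obtain ⟨c, hcs, rfl⟩ := (Finsupp.mem_span_image_iff_linearCombination k).1 hxL
    rw [Finsupp.linearCombination_apply_of_mem_supported k hcs] at hxR ⊢
    -- Right multiplication by the generator just below the end of the tail of `p` keeps only the
    -- words with that same tail end. Their images are distinct basis elements, so each coefficient
    -- vanishes.
    have hc : ∀ p ∈ leftPrimIndex r d, p.2 ≠ 0 → c p = 0 := by
      intro p hp hp0
      obtain ⟨j, hj⟩ : ∃ j, p.2.val = j + 1 :=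
        Nat.exists_eq_succ_of_ne_zero fun h => hp0 (Fin.ext h)
      have hjr : j < r := by omega
      have h0 := hxR _ (T_mem_maxIdeal k _ ⟨j, by omega⟩)
      rw [← genA_val, Finset.sum_mul] at h0
      have h1 := DFunLike.congr_fun (congrArg (typeANormalForm r d k hd).coord h0)
        (primIndex r p.1 j)
      rw [map_sum, Finsupp.finsetSum_apply, Finset.sum_eq_single p, map_zero] at h1
      · have hp1 : 2 ≤ p.1 ∧ p.1 ≤ d - 1 := (mem_leftPrimIndex.1 hp).resolve_left
          (by rintro rfl; exact hp0 rfl)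
        rw [smul_mul_assoc, primWord_mul_genA r d k hjr (by omega), if_pos hj, map_smul,
          ← nfA_primIndex k (by omega) (by omega)] at h1
        have h2 := (typeANormalForm r d k hd).coord_nf
          (x := primIndex r p.1 j) (primIndex_mem (by omega) (by omega) (by omega))
        change (typeANormalForm r d k hd).coord (nfA r d k _) = _ at h2
        rw [h2] at h1
        simpa using h1
      · intro q hq hqp
        rw [smul_mul_assoc, primWord_mul_genA r d k hjr (by omega), map_smul]
        split_ifs with hqj
        · have hq0 : q.2 ≠ 0 := fun h => by rw [h] at hqj; simp at hqj
          have hq1 : 2 ≤ q.1 ∧ q.1 ≤ d - 1 := (mem_leftPrimIndex.1 hq).resolve_left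
            (by rintro rfl; exact hq0 rfl)
          have h2 := (typeANormalForm r d k hd).coord_nf
            (x := primIndex r q.1 j) (primIndex_mem (by omega) (by omega) (by omega))
          change (typeANormalForm r d k hd).coord (nfA r d k _) = _ at h2
          rw [← nfA_primIndex k (by omega) (by omega), h2, Finsupp.smul_apply,
            Finsupp.single_eq_of_ne, smul_zero]
          intro h
          obtain ⟨h3, -⟩ := primIndex_injective (by omega) (by omega) h
          exact hqp (Prod.ext h3.symm (Fin.ext (by omega)))
        · simp
      · exact fun h => absurd hp h
    refine Submodule.sum_mem _ fun p hp => ?_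
    by_cases hp0 : p.2 = 0
    · refine Submodule.smul_mem _ _ (Submodule.subset_span ⟨p.1, ?_, by rw [hp0]; rfl⟩)
      obtain rfl | h := mem_leftPrimIndex.1 hp
      · exact ⟨le_rfl, by simp only; omega⟩
      · exact ⟨by omega, h.2⟩
    · rw [hc p hp hp0, zero_smul]
      exact zero_mem _
  · rw [Submodule.span_le]
    rintro _ ⟨a, ⟨ha, had⟩, rfl⟩
    have hL : primWord r d k a 0 ∈ primL k (typeA (r + 1) d) := by
      rw [primL_typeA k hr hd]
      refine Submodule.subset_span ⟨(a, 0), ?_, rfl⟩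
      rw [Finset.mem_coe, mem_leftPrimIndex]
      obtain rfl | h : a = 1 ∨ 2 ≤ a := by omega
      · exact Or.inl rfl
      · exact Or.inr ⟨h, had⟩
    obtain ⟨θ, hθ⟩ := exists_isAntiInvolution k (typeA (r + 1) d)
    refine ⟨hL, ?_⟩
    have := hθ.map_mem_primR hL
    rwa [hθ.map_primWord] at this

theorem IsAntiInvolution.apply_eq_self_of_mem_prim_typeA (hr : 1 ≤ r) (hd : 2 ≤ d)
    {θ : NCA k (r + 1) d →ₗ[k] NCA k (r + 1) d} (hθ : IsAntiInvolution k (typeA (r + 1) d) θ)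
    {x : NCA k (r + 1) d} (hx : x ∈ prim k (typeA (r + 1) d)) : θ x = x := by
  rw [prim_typeA k hr hd] at hx
  refine apply_eq_self_of_mem_span ?_ hx
  rintro _ ⟨a, -, rfl⟩
  exact hθ.map_primWord a

/-- The primitive elements of `NC_A(1, d)`. -/
theorem prim_typeA_one (hd : 2 ≤ d) :
    primL k (typeA 1 d) = Submodule.span k {T k (typeA 1 d) 0 ^ (d - 1)} ∧
      primR k (typeA 1 d) = Submodule.span k {T k (typeA 1 d) 0 ^ (d - 1)} ∧
      prim k (typeA 1 d) = Submodule.span k {T k (typeA 1 d) 0 ^ (d - 1)} ∧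
      ∀ θ : NCA k 1 d →ₗ[k] NCA k 1 d, IsAntiInvolution k (typeA 1 d) θ →
        ∀ x ∈ prim k (typeA 1 d), θ x = x := by
  have hw : primWord 0 d k (d - 1) 0 = T k (typeA 1 d) 0 ^ (d - 1) := by
    rw [primWord, genA_last]
    simp [stair, block]
  have hL : primL k (typeA 1 d) = Submodule.span k {T k (typeA 1 d) 0 ^ (d - 1)} := by
    rw [(typeANormalForm 0 d k hd).primL_eq, ← hw]
    congr 1
    ext y
    constructor
    · rintro ⟨x, ⟨hx, hdead⟩, rfl⟩
      obtain ⟨a, m, rfl, ha, had, hm, -, h⟩ := (typeAAct_eq_none_iff hx).1 hdead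
      obtain rfl : m = 0 := by omega
      obtain rfl : a = d - 1 := by have := h rfl; omega
      exact nfA_primIndex k ha hm
    · rintro rfl
      have hmem : primIndex 0 (d - 1) 0 ∈ typeAIndex 0 d :=
        primIndex_mem (by omega) (by omega) le_rfl
      exact ⟨_, ⟨hmem, (typeAAct_eq_none_iff hmem).2
        ⟨d - 1, 0, rfl, by omega, by omega, le_rfl, fun _ => rfl, fun _ => by omega⟩⟩,
        nfA_primIndex k (by omega) le_rfl⟩
  have hfix : ∀ θ : NCA k 1 d →ₗ[k] NCA k 1 d, IsAntiInvolution k (typeA 1 d) θ →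
      ∀ x ∈ ({T k (typeA 1 d) 0 ^ (d - 1)} : Set (NCA k 1 d)), θ x = x := by
    rintro θ hθ x rfl
    rw [← hw]
    exact hθ.map_primWord (r := 0) _
  obtain ⟨θ, hθ⟩ := exists_isAntiInvolution k (typeA 1 d)
  have hR := hθ.primR_eq_span hL (hfix θ hθ)
  exact ⟨hL, hR, by rw [prim, hL, hR, inf_idem], fun θ hθ x hx =>
    apply_eq_self_of_mem_span (hfix θ hθ) (hL ▸ hx.1)⟩

end GenCoxeterMatrix

/-! ### Assembly of the assertions. -/

open GenCoxeterMatrix in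
theorem mainTheorem5 (k : Type*) [CommRing k] :
    -- every `NC(M)` has an anti-involution fixing the generators, which exchanges left- and
    -- right-primitive elements, and preserves `Prim` and the length of each nonzero word
    (∀ (I : Type*) [Finite I] (M : GenCoxeterMatrix I),
      ∃ θ : NC k M →ₗ[k] NC k M, IsAntiInvolution k M θ ∧
        (primL k M).map θ = primR k M ∧ (primR k M).map θ = primL k M ∧
        (prim k M).map θ = prim k M ∧
        ∀ ω : List I, word k M ω ≠ 0 →
          wordLength (T k M) (word k M ω) = ω.length ∧
          (∃ ω' : List I, word k M ω' = θ (word k M ω)) ∧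
          wordLength (T k M) (θ (word k M ω)) = wordLength (T k M) (word k M ω)) ∧
    -- finite Coxeter groups
    (∀ (I : Type*) [Finite I] (M : GenCoxeterMatrix I), (∀ i, M.m i i = 2) →
      Finite M.coxeterMatrix.Group →
      ∃ w₀ : M.coxeterMatrix.Group,
        (∀ w, w ≠ w₀ →
          M.coxeterMatrix.toCoxeterSystem.length w < M.coxeterMatrix.toCoxeterSystem.length w₀) ∧
        (∀ ω : List I, M.coxeterMatrix.toCoxeterSystem.IsReduced ω →
          M.coxeterMatrix.toCoxeterSystem.wordProd ω = w₀ →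
          primL k M = Submodule.span k {word k M ω} ∧
          primR k M = Submodule.span k {word k M ω} ∧
          prim k M = Submodule.span k {word k M ω}) ∧
        ∀ θ : NC k M →ₗ[k] NC k M, IsAntiInvolution k M θ → ∀ x ∈ prim k M, θ x = x) ∧
    -- `NC_A(1, d)`
    (∀ d : ℕ, 2 ≤ d →
      primL k (typeA 1 d) = Submodule.span k {T k (typeA 1 d) 0 ^ (d - 1)} ∧
      primR k (typeA 1 d) = Submodule.span k {T k (typeA 1 d) 0 ^ (d - 1)} ∧
      prim k (typeA 1 d) = Submodule.span k {T k (typeA 1 d) 0 ^ (d - 1)} ∧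
      ∀ θ : NCA k 1 d →ₗ[k] NCA k 1 d, IsAntiInvolution k (typeA 1 d) θ →
        ∀ x ∈ prim k (typeA 1 d), θ x = x) ∧
    -- `NC_A(n, d)` with `n = r + 1 ≥ 2` and `d ≥ 3`
    (∀ r d : ℕ, 1 ≤ r → 3 ≤ d →
      (∀ ω : List (Fin r), IsLongestWord r ω →
        primL k (typeA (r + 1) d) =
          Submodule.span k
            ((fun p => stdWord k r d ω p.1 p.2) '' (leftPrimIndex r d : Set (ℕ × Fin (r + 1)))) ∧
        LinearIndepOn k (fun p => stdWord k r d ω p.1 p.2)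
          (leftPrimIndex r d : Set (ℕ × Fin (r + 1))) ∧
        prim k (typeA (r + 1) d) =
          Submodule.span k ((fun a => stdWord k r d ω a 0) '' Set.Icc 1 (d - 1)) ∧
        LinearIndepOn k (fun a => stdWord k r d ω a 0) (Set.Icc 1 (d - 1))) ∧
      ∀ θ : NCA k (r + 1) d →ₗ[k] NCA k (r + 1) d, IsAntiInvolution k (typeA (r + 1) d) θ →
        ∀ x ∈ prim k (typeA (r + 1) d), θ x = x) := by
  refine ⟨fun I _ M => ?_, fun I _ M hM _ => prim_of_finite_coxeterGroup k hM,
    fun d hd => prim_typeA_one k hd, fun r d hr hd => ⟨fun ω hω => ?_, fun θ hθ x hx =>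
      hθ.apply_eq_self_of_mem_prim_typeA k hr (by omega) hx⟩⟩
  · obtain ⟨θ, hθ⟩ := exists_isAntiInvolution k M
    exact ⟨θ, hθ, hθ.map_primL, hθ.map_primR, hθ.map_prim, fun ω h0 => hθ.wordLength_map k M h0⟩
  · have hd2 : 2 ≤ d := by omega
    simp only [stdWord_eq_primWord r d k hd2 hω, Fin.val_zero]
    refine ⟨primL_typeA k hr hd2, linearIndepOn_primWord k hd2 fun p hp => ?_,
      prim_typeA k hr hd2, ?_⟩
    · rw [Finset.mem_coe, mem_leftPrimIndex] at hp
      obtain rfl | h := hp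
      · exact ⟨le_rfl, by simp only; omega⟩
      · omega
    · have h := linearIndepOn_primWord k (r := r) hd2
        (s := (fun a => (a, (0 : Fin (r + 1)))) '' Set.Icc 1 (d - 1)) (by
          rintro _ ⟨a, ⟨h1, h2⟩, rfl⟩
          exact ⟨h1, by simp only; omega⟩)
      exact h.comp_of_image fun a _ b _ hab => congrArg Prod.fst hab
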